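/- **Setting.** Let $\alpha\ge 0$, $\omega_c>0$, $\omega_0,\delta\in\mathbb R$ and $\hbar=1$. For a spectral density $J:\mathbb R\to[0,\infty)$ consider the spin-boson model on $\mathbb C^2\otimes\mathcal F$, with $\mathcal F$ the bosonic Fock space, whose Hamiltonian in the interaction picture with respect to the bath is $$H_J(t)=\tfrac{\omega_0}{2}\sigma_z+\delta\sigma_x+\sigma_x\int d\omega\,\sqrt{J(\omega)}\,\bigl(a_\omega e^{-i\omega t}+a_\omega^\dagger e^{i\omega t}\bigr).$$ Let $U_J(t)=T\exp\bigl(-i\int_0^tH_J(s)\,ds\bigr)$ be given by its Dyson series. For a density matrix $\rho$ of the spin let $\rho_J(t)=\mathrm{tr}_{\mathcal F}\bigl(U_J(t)(\rho\otimes|0\rangle\langle 0|)U_J(t)^\dagger\bigr)$ and $\langle\sigma_z\rangle_J(t)=\mathrm{tr}(\sigma_z\rho_J(t))$. The bath correlation function is $C_J(\tau)=\int J(\omega)e^{-i\omega\tau}\,d\omega$. Let $J(\omega)=2\alpha\omega$ for $\omega\in[0,\omega_c]$ and $J(\omega)=0$ otherwise (Ohmic spectral density). For a time step $\Delta t>0$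 let $J_{\Delta t}(\omega)=J(\omega)$ for $\omega\le\pi/\Delta t$ and $J_{\Delta t}(\omega)=0$ for $\omega>\pi/\Delta t$; this is the part of the bath that a non-Markovian collision model sampling the bath with step $\Delta t$ resolves. Put $\Delta C=C_J-C_{J_{\Delta t}}$, and define the sampling error after a single time step by $$\epsilon_{\rm samp}=\bigl|\langle\sigma_z\rangle_J(\Delta t)-\langle\sigma_z\rangle_{J_{\Delta t}}(\Delta t)\bigr| .$$ **Claim.** For every density matrix $\rho$ and every $\Delta t>0$, both reduced dynamics are well defined at time $\Delta t$: the Dyson series converges for the amplitude of every boson configuration, the traces over the $n$-boson sectors and the sum over $n$ converge, and $\rho_J(\Delta t)$, $\rho_{J_{\Delta t}}(\Delta t)$ are density matrices. Moreover: 1. $\displaystyle \epsilon_{\rm samp}\le\exp\Bigl(4\int_0^{\Delta t}dt'\int_0^{t'}dt''\,|\Delta C(t'-t'')|\Bigr)-1.$ 2. If $\Delta t\le\pi/\omega_c$, then $C_J$ is perfectly reconstructed from its samples, $C_J(\tau)=\sum_{n\in\mathbb Z}C_J(n\Delta t)\,\mathrm{sinc}\bigl(\pi(\tau/\Delta t-n)\bigr)$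 for all $\tau\in\mathbb R$ (with $\mathrm{sinc}\,x=\sin x/x$, $\mathrm{sinc}\,0=1$), $\Delta C=0$, and $\epsilon_{\rm samp}=0$. 3. If $\Delta t\ge\pi/\omega_c$, then for all $\tau\in\mathbb R$ $$\Delta C(\tau)=\int_{\pi/\Delta t}^{\omega_c}2\alpha\omega e^{-i\omega\tau}\,d\omega,$$ which for $\tau\ne0$ equals $$\frac{2\alpha}{\tau^2}\Bigl(e^{-i\omega_c\tau}(1+i\omega_c\tau)-e^{-i\pi\tau/\Delta t}\bigl(1+i\tfrac{\pi\tau}{\Delta t}\bigr)\Bigr),$$ and $$\epsilon_{\rm samp}\le 2\pi^2\alpha\Bigl(\Bigl(\frac{\omega_c\Delta t}{\pi}\Bigr)^2-1\Bigr)\le 2\alpha\omega_c^2\,\Delta t^2 .$$ In particular the sampling error is $O(\Delta t^2)$ on $\Delta t\ge\pi/\omega_c$, with a constant that depends only on $\alpha$ and $\omega_c$. -/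

import Mathlib

noncomputable section

namespace SpinBoson

open scoped ComplexOrder

/-! ### Bath correlation functions -/

/-- The Ohmic spectral density with hard cut-off: `2 α ω` on `[0, ωc]`, zero elsewhere. -/
def ohmicSD (α ωc : ℝ) : ℝ → ℝ :=
  (Set.Icc 0 ωc).indicator fun ω => 2 * α * ω

/-- The part of a spectral density that is resolved with time step `Δt`: the frequencies up to the
Nyquist frequency `π / Δt`. -/
def sampledSD (J : ℝ → ℝ) (Δt : ℝ) : ℝ → ℝ :=
  (Set.Iic (Real.pi / Δt)).indicator J

/-- The (zero temperature) bath correlation function `C(τ) = ∫ J(ω) exp(-i ω τ) dω`. -/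
def bathCorrelation (J : ℝ → ℝ) (τ : ℝ) : ℂ :=
  ∫ ω : ℝ, (J ω : ℂ) * Complex.exp (-Complex.I * ω * τ)

/-- The difference `ΔC` of the exact bath correlation function and the sampled one. -/
def correlationError (J : ℝ → ℝ) (Δt τ : ℝ) : ℂ :=
  bathCorrelation J τ - bathCorrelation (sampledSD J Δt) τ

/-! ### The spin and the bosonic Fock space -/

def σx : Matrix (Fin 2) (Fin 2) ℂ := !![0, 1; 1, 0]

def σz : Matrix (Fin 2) (Fin 2) ℂ := !![1, 0; 0, -1]

/-- The spin Hamiltonian `(ω₀ / 2) σz + δ σx`. -/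
def systemHamiltonian (ω₀ δ : ℝ) : Matrix (Fin 2) (Fin 2) ℂ :=
  ((ω₀ / 2 : ℝ) : ℂ) • σz + (δ : ℂ) • σx

/-- Density matrices of the spin. -/
def IsDensityMatrix (ρ : Matrix (Fin 2) (Fin 2) ℂ) : Prop :=
  ρ.PosSemidef ∧ ρ.trace = 1

/-- Linear maps from `ℂ²` to `ℂ² ⊗ Fock`, given by their boson amplitudes: `Ψ n (ω₁, …, ωₙ)` is the
component with `n` bosons of frequencies `ω₁, …, ωₙ`, a `2 × 2` matrix acting on the spin.
Column `j` of `Ψ` is the spin-boson wave function that evolved from the spin basis state `j`.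
Frequencies range over `ℝ`; a mode that `J` does not couple (such as one of negative frequency)
stays empty. -/
abbrev FockMap := (n : ℕ) → (Fin n → ℝ) → Matrix (Fin 2) (Fin 2) ℂ

/-- `u ↦ u ⊗ |vacuum⟩`. -/
def vacuum : FockMap := fun n _ => if n = 0 then 1 else 0

/-- The annihilation operator `a(f) = ∫ conj (f ω) a_ω dω`. -/
def annihilate (f : ℝ → ℂ) (Ψ : FockMap) : FockMap := fun n ω =>
  ((Real.sqrt (n + 1) : ℝ) : ℂ) •
    Matrix.of fun a b => ∫ x : ℝ, starRingEnd ℂ (f x) * Ψ (n + 1) (Fin.cons x ω) a b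

/-- The creation operator `a†(f) = ∫ f ω a†_ω dω`. -/
def create (f : ℝ → ℂ) (Ψ : FockMap) : FockMap
  | 0, _ => 0
  | n + 1, ω =>
    ((1 / Real.sqrt (n + 1) : ℝ) : ℂ) •
      ∑ j : Fin (n + 1), f (ω j) • Ψ n (fun i => ω (j.succAbove i))

/-- The coupling function `√J(ω) exp(i ω t)` in the interaction picture of the bath. -/
def coupling (J : ℝ → ℝ) (t : ℝ) : ℝ → ℂ := fun ω =>
  ((Real.sqrt (J ω) : ℝ) : ℂ) * Complex.exp (Complex.I * ω * t)

/-- The spin-boson Hamiltonian in the interaction picture with respect to the bath (`ħ = 1`),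
`H(t) = H_S + σx ∫ √J(ω) (a_ω exp(-i ω t) + a†_ω exp(i ω t)) dω`. -/
def hamiltonian (ω₀ δ : ℝ) (J : ℝ → ℝ) (t : ℝ) (Ψ : FockMap) : FockMap := fun n ω =>
  systemHamiltonian ω₀ δ * Ψ n ω +
    σx * (annihilate (coupling J t) Ψ n ω + create (coupling J t) Ψ n ω)

/-! ### Time evolution -/

/-- The `k`-th term of the time-ordered exponential applied to the bath vacuum,
`(-i)^k ∫_{0 ≤ s₁ ≤ … ≤ s_k ≤ t} H(s_k) ⋯ H(s₁) ( · ⊗ |vacuum⟩)`. -/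
def dysonTerm (ω₀ δ : ℝ) (J : ℝ → ℝ) : ℕ → ℝ → FockMap
  | 0, _ => vacuum
  | k + 1, t => fun n ω =>
    (-Complex.I) • Matrix.of fun a b =>
      ∫ s in (0 : ℝ)..t, hamiltonian ω₀ δ J s (dysonTerm ω₀ δ J k s) n ω a b

/-- `u ↦ U(t) (u ⊗ |vacuum⟩)` with `U(t) = T exp(-i ∫₀ᵗ H(s) ds)`. -/
def evolved (ω₀ δ : ℝ) (J : ℝ → ℝ) (t : ℝ) : FockMap := fun n ω =>
  ∑' k : ℕ, dysonTerm ω₀ δ J k t n ω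

/-- The contribution of the `n`-boson sector to the reduced spin state. -/
def sectorState (ω₀ δ : ℝ) (J : ℝ → ℝ) (ρ : Matrix (Fin 2) (Fin 2) ℂ) (t : ℝ) (n : ℕ) :
    Matrix (Fin 2) (Fin 2) ℂ :=
  Matrix.of fun a b => ∫ ω : Fin n → ℝ,
    (evolved ω₀ δ J t n ω * ρ * (evolved ω₀ δ J t n ω).conjTranspose) a b

/-- The reduced spin state `tr_B (U(t) (ρ ⊗ |vacuum⟩⟨vacuum|) U(t)†)`. -/
def reducedState (ω₀ δ : ℝ) (J : ℝ → ℝ) (ρ : Matrix (Fin 2) (Fin 2) ℂ) (t : ℝ) :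
    Matrix (Fin 2) (Fin 2) ℂ :=
  ∑' n : ℕ, sectorState ω₀ δ J ρ t n

/-- The Dyson series, the partial trace over each sector and the sum over the sectors converge, and
the reduced state at time `t` is a density matrix. -/
def EvolutionWellDefined (ω₀ δ : ℝ) (J : ℝ → ℝ) (ρ : Matrix (Fin 2) (Fin 2) ℂ) (t : ℝ) : Prop :=
  (∀ (n : ℕ) (ω : Fin n → ℝ), Summable fun k : ℕ => dysonTerm ω₀ δ J k t n ω) ∧
  (∀ (n : ℕ) (a b : Fin 2), MeasureTheory.Integrable fun ω : Fin n → ℝ =>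
    (evolved ω₀ δ J t n ω * ρ * (evolved ω₀ δ J t n ω).conjTranspose) a b) ∧
  (Summable fun n : ℕ => sectorState ω₀ δ J ρ t n) ∧
  IsDensityMatrix (reducedState ω₀ δ J ρ t)

/-- The expectation value `⟨σz⟩(t)`. -/
def expectSigmaZ (ω₀ δ : ℝ) (J : ℝ → ℝ) (ρ : Matrix (Fin 2) (Fin 2) ℂ) (t : ℝ) : ℂ :=
  (σz * reducedState ω₀ δ J ρ t).trace

/-- The sampling error: the change of `⟨σz⟩` after a single time step `Δt` that is caused by
replacing the bath with the one that is resolved with time step `Δt`. -/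
def samplingError (ω₀ δ : ℝ) (J : ℝ → ℝ) (ρ : Matrix (Fin 2) (Fin 2) ℂ) (Δt : ℝ) : ℝ :=
  ‖expectSigmaZ ω₀ δ J ρ Δt - expectSigmaZ ω₀ δ (sampledSD J Δt) ρ Δt‖

end SpinBoson

end

noncomputable section

namespace SpinBoson

open MeasureTheory
open scoped ComplexOrder

/-! ### Couplings and rapidly decaying families of Fock maps -/

/-! Let `ψ(t)` and `φ(t)` be the vacuum evolutions with the full and the sampled bath, `P` the
projection onto configurations without bosons above `π / Δt`, and `h` the coupling of the unresolved
modes. Both evolutions conserve the norm weighted by `ρ`.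

Applying `P` to the Schrödinger equation of `ψ` gives the equation of the sampled bath with one
extra source, `-i σx P a(h_t) ψ(t)`: creation of an unresolved boson is killed by `P`, but its
reabsorption is not (`lowPass_hamiltonian`). The size of `a(h_τ) ψ(t)` at frozen `τ` is found the
same way: by the commutation relations it solves the full equation with source `-i ΔC(τ - t) σx
ψ(t)`, and it vanishes at `t = 0` because the bath starts empty. As the Hamiltonian part does not
change norms, `‖a(h_τ) ψ(t)‖ ≤ ∫₀ᵗ |ΔC(τ - s)| ds` (`sqrt_fockNormSq_annihilate_le`). Taking `τ = t`
and integrating once more bounds `‖Pψ - φ‖` by the double integral `D` of `|ΔC|`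
(`sqrt_fockNormSq_lowPass_sub_le`).

The observable acts on the spin only, so it has no matrix elements between `Pψ` and `ψ - Pψ`. The
resolved part changes the expectation by at most `2D`, and the lost weight `‖ψ‖² - ‖Pψ‖² = ‖φ‖² -
‖Pψ‖²` contributes at most `2D`. Hence the error is at most `4D` (`samplingError_le`), which is
stronger than the exponential bound. The quadratic bounds follow from a sup bound on `ΔC`; for small
steps the two baths coincide, and reconstruction is Parseval's identity on `[-π/Δt, π/Δt]`.

The analytic side rests on sup bounds: couplings are bounded on a band of finite measure, and the
evolved amplitudes decay faster than geometrically in the boson number (`RapidFamily`). This class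
is stable under all operations needed, which justifies every interchange of sums, integrals and
derivatives. -/

/-- Time-dependent coupling functions that are bounded by `M` and supported in `[0, Ω]`. -/
structure IsBandFamily (Ω M : ℝ) (f : ℝ → ℝ → ℂ) : Prop where
  measurable : ∀ t, Measurable (f t)
  continuous : ∀ x, Continuous fun t => f t x
  norm_le : ∀ t x, ‖f t x‖ ≤ M
  eq_zero : ∀ t x, x ∉ Set.Icc 0 Ω → f t x = 0

/-- Lebesgue measure on the frequency band `[0, Ω]`. -/
def bandMeasure (Ω : ℝ) : Measure ℝ := volume.restrict (Set.Icc 0 Ω)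

instance (Ω : ℝ) : IsFiniteMeasure (bandMeasure Ω) := by
  unfold bandMeasure; infer_instance

/-- The length of the frequency band. -/
def bandLength (Ω : ℝ) : ℝ := (bandMeasure Ω).real Set.univ

lemma bandLength_nonneg (Ω : ℝ) : 0 ≤ bandLength Ω := measureReal_nonneg

/-- Time-dependent Fock maps that are measurable in the frequencies, continuous in time, and decay
faster than any geometric sequence in the number of bosons, locally uniformly in time. -/
structure RapidFamily (Ψ : ℝ → FockMap) : Prop where
  measurable : ∀ t n a b, Measurable fun ω => Ψ t n ω a b
  continuous : ∀ n ω a b, Continuous fun t => Ψ t n ω a b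
  bound : ∀ T r : ℝ, 0 ≤ r → ∃ C, 0 ≤ C ∧
    ∀ t, |t| ≤ T → ∀ n ω a b, r ^ n * ‖Ψ t n ω a b‖ ≤ C

lemma IsBandFamily.nonneg {Ω M : ℝ} {f : ℝ → ℝ → ℂ} (hf : IsBandFamily Ω M f) : 0 ≤ M :=
  (norm_nonneg _).trans (hf.norm_le 0 0)

lemma IsBandFamily.const {Ω M : ℝ} {f : ℝ → ℝ → ℂ} (hf : IsBandFamily Ω M f) (τ : ℝ) :
    IsBandFamily Ω M fun _ => f τ :=
  ⟨fun _ => hf.measurable τ, fun _ => continuous_const, fun _ => hf.norm_le τ,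
    fun _ => hf.eq_zero τ⟩

/-- The coupling vanishes off the band, so the integral lives on a finite measure, where bounded
integrands are integrable. -/
lemma annihilate_apply {Ω M : ℝ} {f : ℝ → ℝ → ℂ} (hf : IsBandFamily Ω M f) (t : ℝ) (Ψ : FockMap)
    (n : ℕ) (ω : Fin n → ℝ) (a b : Fin 2) :
    annihilate (f t) Ψ n ω a b = ((Real.sqrt (n + 1) : ℝ) : ℂ) *
      ∫ x, starRingEnd ℂ (f t x) * Ψ (n + 1) (Fin.cons x ω) a b ∂bandMeasure Ω := by
  have h : ∫ x, starRingEnd ℂ (f t x) * Ψ (n + 1) (Fin.cons x ω) a b ∂bandMeasure Ω =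
      ∫ x, starRingEnd ℂ (f t x) * Ψ (n + 1) (Fin.cons x ω) a b :=
    setIntegral_eq_integral_of_forall_compl_eq_zero fun x hx => by simp [hf.eq_zero t x hx]
  rw [h]
  rfl

lemma create_succ_apply (f : ℝ → ℂ) (Ψ : FockMap) (n : ℕ) (ω : Fin (n + 1) → ℝ) (a b : Fin 2) :
    create f Ψ (n + 1) ω a b = ((1 / Real.sqrt (n + 1) : ℝ) : ℂ) *
      ∑ j : Fin (n + 1), f (ω j) * Ψ n (fun i => ω (j.succAbove i)) a b := by
  simp only [create, Matrix.smul_apply, Matrix.sum_apply, smul_eq_mul]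

lemma create_zero_apply (f : ℝ → ℂ) (Ψ : FockMap) (ω : Fin 0 → ℝ) (a b : Fin 2) :
    create f Ψ 0 ω a b = 0 := rfl

lemma norm_annihilate_le {Ω M : ℝ} {f : ℝ → ℝ → ℂ} (hf : IsBandFamily Ω M f) (t : ℝ) (Ψ : FockMap)
    (n : ℕ) (ω : Fin n → ℝ) (a b : Fin 2) {C : ℝ}
    (hC : ∀ x, ‖Ψ (n + 1) (Fin.cons x ω) a b‖ ≤ C) :
    ‖annihilate (f t) Ψ n ω a b‖ ≤ Real.sqrt (n + 1) * (M * C * bandLength Ω) := by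
  rw [annihilate_apply hf, norm_mul, Complex.norm_real, Real.norm_of_nonneg (Real.sqrt_nonneg _)]
  gcongr
  refine norm_integral_le_of_norm_le_const (Filter.Eventually.of_forall fun x => ?_)
  rw [norm_mul, RCLike.norm_conj]
  exact mul_le_mul (hf.norm_le t x) (hC x) (norm_nonneg _) hf.nonneg

/-- There are `n + 1` summands of size `M * C`, normalised by `1 / √(n + 1)`. -/
lemma norm_create_succ_le {Ω M : ℝ} {f : ℝ → ℝ → ℂ} (hf : IsBandFamily Ω M f) (t : ℝ)
    (Ψ : FockMap) (n : ℕ) (ω : Fin (n + 1) → ℝ) (a b : Fin 2) {C : ℝ}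
    (hC : ∀ ω', ‖Ψ n ω' a b‖ ≤ C) :
    ‖create (f t) Ψ (n + 1) ω a b‖ ≤ Real.sqrt (n + 1) * (M * C) := by
  have hs : (0 : ℝ) < Real.sqrt (n + 1) := Real.sqrt_pos.2 (by positivity)
  rw [create_succ_apply, norm_mul, Complex.norm_real, Real.norm_of_nonneg (by positivity)]
  have h : ‖∑ j : Fin (n + 1), f t (ω j) * Ψ n (fun i => ω (j.succAbove i)) a b‖ ≤
      (n + 1) * (M * C) := by
    refine (norm_sum_le_of_le (f := fun j : Fin (n + 1) =>
      f t (ω j) * Ψ n (fun i => ω (j.succAbove i)) a b) (n := fun _ => M * C) _ fun j _ => ?_).trans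
      (by simp)
    rw [norm_mul]
    exact mul_le_mul (hf.norm_le t _) (hC _) (norm_nonneg _) hf.nonneg
  calc 1 / Real.sqrt (n + 1) * _ ≤ 1 / Real.sqrt (n + 1) * ((n + 1) * (M * C)) := by gcongr
    _ = Real.sqrt (n + 1) * (M * C) := by
      rw [← mul_assoc]
      congr 1
      rw [one_div, inv_mul_eq_div, div_eq_iff hs.ne', Real.mul_self_sqrt (by positivity)]

/-- A crude bound suffices: the square roots from creation and annihilation are absorbed by
enlarging the geometric rate `r`. -/
lemma sqrt_succ_le_two_pow (n : ℕ) : Real.sqrt (n + 1) ≤ 2 ^ n := by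
  have h : ((n : ℝ) + 1) ≤ 2 ^ n := by exact_mod_cast Nat.lt_two_pow_self (n := n)
  rw [Real.sqrt_le_left (by positivity)]
  exact h.trans (le_self_pow₀ (one_le_pow₀ (by norm_num)) (by norm_num))

namespace RapidFamily

variable {Ψ Φ : ℝ → FockMap}

lemma at_time (h : RapidFamily Ψ) (t : ℝ) : RapidFamily fun _ => Ψ t :=
  ⟨fun _ => h.measurable t, fun _ _ _ _ => continuous_const, fun _ r hr => by
    obtain ⟨C, hC0, hC⟩ := h.bound |t| r hr
    exact ⟨C, hC0, fun _ _ => hC t le_rfl⟩⟩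

lemma add (h : RapidFamily Ψ) (h' : RapidFamily Φ) :
    RapidFamily fun t n ω => Ψ t n ω + Φ t n ω := by
  refine ⟨fun t n a b => (h.measurable t n a b).add (h'.measurable t n a b),
    fun n ω a b => (h.continuous n ω a b).add (h'.continuous n ω a b), fun T r hr => ?_⟩
  obtain ⟨C, hC0, hC⟩ := h.bound T r hr
  obtain ⟨C', hC0', hC'⟩ := h'.bound T r hr
  refine ⟨C + C', by positivity, fun t ht n ω a b => ?_⟩
  calc r ^ n * ‖Ψ t n ω a b + Φ t n ω a b‖
      ≤ r ^ n * (‖Ψ t n ω a b‖ + ‖Φ t n ω a b‖) := by gcongr; exact norm_add_le _ _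
    _ ≤ C + C' := by rw [mul_add]; exact add_le_add (hC t ht n ω a b) (hC' t ht n ω a b)

lemma smul_of_bounded (h : RapidFamily Ψ) {c : ℝ → ℂ} (hc : Continuous c) :
    RapidFamily fun t n ω => c t • Ψ t n ω := by
  refine ⟨fun t n a b => (h.measurable t n a b).const_mul (c t),
    fun n ω a b => hc.mul (h.continuous n ω a b), fun T r hr => ?_⟩
  obtain ⟨C, hC0, hC⟩ := h.bound T r hr
  obtain ⟨D, hD⟩ := (isCompact_Icc (a := -T) (b := T)).exists_bound_of_continuousOn hc.continuousOn
  refine ⟨|D| * C, by positivity, fun t ht n ω a b => ?_⟩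
  rw [Matrix.smul_apply, norm_smul, mul_left_comm]
  exact mul_le_mul ((hD t (abs_le.1 ht)).trans (le_abs_self D)) (hC t ht n ω a b)
    (by positivity) (by positivity)

lemma smul (h : RapidFamily Ψ) (c : ℂ) : RapidFamily fun t n ω => c • Ψ t n ω :=
  h.smul_of_bounded continuous_const

lemma sub (h : RapidFamily Ψ) (h' : RapidFamily Φ) :
    RapidFamily fun t n ω => Ψ t n ω - Φ t n ω := by
  simpa [sub_eq_add_neg] using h.add (h'.smul (-1))

lemma mul_left (h : RapidFamily Ψ) (K : Matrix (Fin 2) (Fin 2) ℂ) :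
    RapidFamily fun t n ω => K * Ψ t n ω := by
  have e : ∀ t n ω a b, (K * Ψ t n ω) a b = K a 0 * Ψ t n ω 0 b + K a 1 * Ψ t n ω 1 b :=
    fun t n ω a b => by simp [Matrix.mul_apply, Fin.sum_univ_two]
  refine ⟨fun t n a b => ?_, fun n ω a b => ?_, fun T r hr => ?_⟩
  · simp only [e]
    exact ((h.measurable t n 0 b).const_mul _).add ((h.measurable t n 1 b).const_mul _)
  · simp only [e]
    exact (continuous_const.mul (h.continuous n ω 0 b)).add
      (continuous_const.mul (h.continuous n ω 1 b))
  · obtain ⟨C, hC0, hC⟩ := h.bound T r hr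
    obtain ⟨D, hD⟩ : ∃ D, ∀ a b, ‖K a b‖ ≤ D :=
      ⟨∑ a, ∑ b, ‖K a b‖, fun a b => (Finset.single_le_sum (f := fun b => ‖K a b‖)
        (fun _ _ => norm_nonneg _) (Finset.mem_univ b)).trans
        (Finset.single_le_sum (f := fun a => ∑ b, ‖K a b‖)
        (fun _ _ => Finset.sum_nonneg fun _ _ => norm_nonneg _) (Finset.mem_univ a))⟩
    have hD0 : 0 ≤ D := (norm_nonneg _).trans (hD 0 0)
    refine ⟨D * C + D * C, by positivity, fun t ht n ω a b => ?_⟩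
    rw [e]
    calc r ^ n * ‖K a 0 * Ψ t n ω 0 b + K a 1 * Ψ t n ω 1 b‖
        ≤ r ^ n * (‖K a 0‖ * ‖Ψ t n ω 0 b‖ + ‖K a 1‖ * ‖Ψ t n ω 1 b‖) := by
          gcongr; rw [← norm_mul, ← norm_mul]; exact norm_add_le _ _
      _ = ‖K a 0‖ * (r ^ n * ‖Ψ t n ω 0 b‖) + ‖K a 1‖ * (r ^ n * ‖Ψ t n ω 1 b‖) := by ring
      _ ≤ D * C + D * C := by
          gcongr
          exacts [hD _ _, hC t ht n ω 0 b, hD _ _, hC t ht n ω 1 b]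

lemma norm_le (h : RapidFamily Ψ) (T : ℝ) :
    ∃ C, 0 ≤ C ∧ ∀ t, |t| ≤ T → ∀ n ω a b, ‖Ψ t n ω a b‖ ≤ C := by
  obtain ⟨C, hC0, hC⟩ := h.bound T 1 zero_le_one
  exact ⟨C, hC0, fun t ht n ω a b => by simpa using hC t ht n ω a b⟩

lemma measurable_cons (h : RapidFamily Ψ) (t : ℝ) (n : ℕ) (a b : Fin 2) :
    Measurable fun p : (Fin n → ℝ) × ℝ => Ψ t (n + 1) (Fin.cons p.2 p.1) a b := by
  refine (h.measurable t (n + 1) a b).comp (measurable_pi_lambda _ fun i => ?_)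
  refine Fin.cases ?_ (fun i => ?_) i
  · simpa using measurable_snd
  · simp only [Fin.cons_succ]
    exact (measurable_pi_apply i).comp measurable_fst

lemma integrable_mul_cons (h : RapidFamily Ψ) {Ω M : ℝ} {f : ℝ → ℝ → ℂ} (hf : IsBandFamily Ω M f)
    (s t : ℝ) (n : ℕ) (ω : Fin n → ℝ) (a b : Fin 2) :
    Integrable (fun x => starRingEnd ℂ (f s x) * Ψ t (n + 1) (Fin.cons x ω) a b)
      (bandMeasure Ω) := by
  obtain ⟨C, hC0, hC⟩ := h.norm_le |t|
  refine Integrable.of_bound (C := M * C) ?_ (Filter.Eventually.of_forall fun x => ?_)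
  · refine (Measurable.mul ?_ ?_).aestronglyMeasurable
    · exact Complex.continuous_conj.measurable.comp (hf.measurable s)
    · exact (h.measurable_cons t n a b).comp (measurable_const.prodMk measurable_id)
  · rw [norm_mul, RCLike.norm_conj]
    exact mul_le_mul (hf.norm_le s x) (hC t le_rfl _ _ _ _) (norm_nonneg _) hf.nonneg

lemma annihilate (h : RapidFamily Ψ) {Ω M : ℝ} {f : ℝ → ℝ → ℂ} (hf : IsBandFamily Ω M f) :
    RapidFamily fun t => SpinBoson.annihilate (f t) (Ψ t) := by
  refine ⟨fun t n a b => ?_, fun n ω a b => ?_, fun T r hr => ?_⟩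
  · simp only [annihilate_apply hf]
    refine Measurable.const_mul ?_ _
    refine (StronglyMeasurable.integral_prod_right
      (f := fun ω x => starRingEnd ℂ (f t x) * Ψ t (n + 1) (Fin.cons x ω) a b)
      (Measurable.stronglyMeasurable ?_)).measurable
    exact (Complex.continuous_conj.measurable.comp ((hf.measurable t).comp measurable_snd)).mul
      (h.measurable_cons t n a b)
  · simp only [annihilate_apply hf]
    refine continuous_const.mul (continuous_iff_continuousAt.2 fun t₀ => ?_)
    obtain ⟨C, hC0, hC⟩ := h.norm_le (|t₀| + 1)
    refine continuousAt_of_dominated (bound := fun _ => M * C)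
      (Filter.Eventually.of_forall fun t => (h.integrable_mul_cons hf t t n ω a b).1) ?_
      (integrable_const _) (Filter.Eventually.of_forall fun x => ?_)
    · filter_upwards [Metric.ball_mem_nhds t₀ one_pos] with t ht
      refine Filter.Eventually.of_forall fun x => ?_
      have : |t| ≤ |t₀| + 1 := by
        rw [Metric.mem_ball, Real.dist_eq] at ht
        linarith [abs_sub_abs_le_abs_sub t t₀]
      rw [norm_mul, RCLike.norm_conj]
      exact mul_le_mul (hf.norm_le t x) (hC t this _ _ _ _) (norm_nonneg _) hf.nonneg
    · exact ((Complex.continuous_conj.comp (hf.continuous x)).mul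
        (h.continuous _ _ a b)).continuousAt
  -- The factor `2` in the rate pays for `√(n + 1)`; the `+ 1` makes the rate at least `1`, so that
  -- passing from `n` to `n + 1` costs nothing.
  · obtain ⟨C, hC0, hC⟩ := h.bound T (2 * r + 1) (by positivity)
    have hM := hf.nonneg
    have hL := bandLength_nonneg Ω
    refine ⟨M * C * bandLength Ω, by positivity, fun t ht n ω a b => ?_⟩
    have hp : (0 : ℝ) < (2 * r + 1) ^ (n + 1) := by positivity
    have h1 := norm_annihilate_le hf t (Ψ t) n ω a b (C := C / (2 * r + 1) ^ (n + 1)) fun x => by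
      rw [le_div_iff₀ hp, mul_comm]; exact hC t ht _ _ a b
    have h2 : r ^ n * Real.sqrt (n + 1) ≤ (2 * r + 1) ^ (n + 1) :=
      calc r ^ n * Real.sqrt (n + 1) ≤ r ^ n * 2 ^ n := by
            gcongr; exact sqrt_succ_le_two_pow n
        _ = (2 * r) ^ n := by rw [← mul_pow, mul_comm]
        _ ≤ (2 * r + 1) ^ n := by gcongr; linarith
        _ ≤ (2 * r + 1) ^ (n + 1) := pow_le_pow_right₀ (by linarith) (Nat.le_succ n)
    calc r ^ n * ‖SpinBoson.annihilate (f t) (Ψ t) n ω a b‖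
        ≤ r ^ n * (Real.sqrt (n + 1) * (M * (C / (2 * r + 1) ^ (n + 1)) * bandLength Ω)) := by
          gcongr
      _ = r ^ n * Real.sqrt (n + 1) * (M * C * bandLength Ω / (2 * r + 1) ^ (n + 1)) := by ring
      _ ≤ (2 * r + 1) ^ (n + 1) * (M * C * bandLength Ω / (2 * r + 1) ^ (n + 1)) := by gcongr
      _ = M * C * bandLength Ω := mul_div_cancel₀ _ hp.ne'

lemma create (h : RapidFamily Ψ) {Ω M : ℝ} {f : ℝ → ℝ → ℂ} (hf : IsBandFamily Ω M f) :
    RapidFamily fun t => SpinBoson.create (f t) (Ψ t) := by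
  refine ⟨fun t n a b => ?_, fun n ω a b => ?_, fun T r hr => ?_⟩
  · cases n with
    | zero => simp only [create_zero_apply]; exact measurable_const
    | succ n =>
      simp only [create_succ_apply]
      refine (Finset.measurable_fun_sum _ fun j _ => ?_).const_mul _
      refine ((hf.measurable t).comp (measurable_pi_apply j)).mul ?_
      exact (h.measurable t n a b).comp (measurable_pi_lambda _ fun i => measurable_pi_apply _)
  · cases n with
    | zero => simp only [create_zero_apply]; exact continuous_const
    | succ n =>
      simp only [create_succ_apply]
      exact continuous_const.mul (continuous_finsetSum _ fun j _ =>
        (hf.continuous _).mul (h.continuous _ _ a b))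
  · obtain ⟨C, hC0, hC⟩ := h.bound T (2 * r + 1) (by positivity)
    have hM := hf.nonneg
    refine ⟨r * (M * C), by positivity, fun t ht n ω a b => ?_⟩
    cases n with
    | zero => simp only [create_zero_apply, norm_zero, mul_zero]; positivity
    | succ n =>
      have hp : (0 : ℝ) < (2 * r + 1) ^ n := by positivity
      have h1 := norm_create_succ_le hf t (Ψ t) n ω a b (C := C / (2 * r + 1) ^ n) fun ω' => by
        rw [le_div_iff₀ hp, mul_comm]; exact hC t ht _ _ a b
      have h2 : r ^ n * Real.sqrt (n + 1) ≤ (2 * r + 1) ^ n :=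
        calc r ^ n * Real.sqrt (n + 1) ≤ r ^ n * 2 ^ n := by
              gcongr; exact sqrt_succ_le_two_pow n
          _ = (2 * r) ^ n := by rw [← mul_pow, mul_comm]
          _ ≤ (2 * r + 1) ^ n := by gcongr; linarith
      calc r ^ (n + 1) * ‖SpinBoson.create (f t) (Ψ t) (n + 1) ω a b‖
          ≤ r ^ (n + 1) * (Real.sqrt (n + 1) * (M * (C / (2 * r + 1) ^ n))) := by gcongr
        _ = r ^ n * Real.sqrt (n + 1) * (r * (M * C) / (2 * r + 1) ^ n) := by ring
        _ ≤ (2 * r + 1) ^ n * (r * (M * C) / (2 * r + 1) ^ n) := by gcongr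
        _ = r * (M * C) := mul_div_cancel₀ _ hp.ne'

lemma hamiltonian (h : RapidFamily Ψ) {Ω M : ℝ} {J : ℝ → ℝ} (hf : IsBandFamily Ω M (coupling J))
    (ω₀ δ : ℝ) : RapidFamily fun t => SpinBoson.hamiltonian ω₀ δ J t (Ψ t) :=
  (h.mul_left _).add (((h.annihilate hf).add (h.create hf)).mul_left _)

lemma timeIntegral (h : RapidFamily Ψ) :
    RapidFamily fun t n ω => Matrix.of fun a b => ∫ s in (0 : ℝ)..t, Ψ s n ω a b := by
  refine ⟨fun t n a b => ?_, fun n ω a b => ?_, fun T r hr => ?_⟩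
  -- Continuity in time together with measurability in the frequencies gives joint measurability,
  -- which the parametric integral needs.
  · have hm : StronglyMeasurable (Function.uncurry fun (s : ℝ) (ω : Fin n → ℝ) => Ψ s n ω a b) :=
      stronglyMeasurable_uncurry_of_continuous_of_stronglyMeasurable
        (fun ω => h.continuous n ω a b) fun s => (h.measurable s n a b).stronglyMeasurable
    have hm' : StronglyMeasurable (Function.uncurry fun (ω : Fin n → ℝ) (s : ℝ) => Ψ s n ω a b) :=
      hm.comp_measurable measurable_swap
    simp only [Matrix.of_apply, intervalIntegral]
    exact (StronglyMeasurable.integral_prod_right hm').measurable.sub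
      (StronglyMeasurable.integral_prod_right hm').measurable
  · exact intervalIntegral.continuous_primitive
      (fun a' b' => (h.continuous n ω a b).intervalIntegrable a' b') 0
  · obtain ⟨C, hC0, hC⟩ := h.bound T r hr
    refine ⟨C * |T|, by positivity, fun t ht n ω a b => ?_⟩
    rw [Matrix.of_apply]
    have e : r ^ n * ‖∫ s in (0 : ℝ)..t, Ψ s n ω a b‖ =
        ‖∫ s in (0 : ℝ)..t, (r : ℂ) ^ n * Ψ s n ω a b‖ := by
      rw [intervalIntegral.integral_const_mul, norm_mul, norm_pow, Complex.norm_real,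
        Real.norm_of_nonneg hr]
    rw [e]
    refine (intervalIntegral.norm_integral_le_of_norm_le_const (C := C) fun s hs => ?_).trans ?_
    · rw [norm_mul, norm_pow, Complex.norm_real, Real.norm_of_nonneg hr]
      refine hC s (le_trans ?_ ht) n ω a b
      have := Set.uIoc_subset_uIcc hs
      simpa using Set.abs_sub_left_of_mem_uIcc this
    · rw [sub_zero]
      exact mul_le_mul_of_nonneg_left (ht.trans (le_abs_self T)) hC0

end RapidFamily

/-! ### Bosonic symmetry -/

/-- Amplitudes that are invariant under permutations of the bosons. -/
def IsBosonic (Ψ : FockMap) : Prop :=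
  ∀ (n : ℕ) (π : Equiv.Perm (Fin n)) (ω : Fin n → ℝ), Ψ n (ω ∘ π) = Ψ n ω

/-- The permutation on the right fixes `0` and acts as `π` on the successors, so symmetry survives
integrating out the first boson. -/
lemma cons_comp_perm {n : ℕ} (x : ℝ) (ω : Fin n → ℝ) (π : Equiv.Perm (Fin n)) :
    (Fin.cons x (ω ∘ π) : Fin (n + 1) → ℝ) =
      (Fin.cons x ω : Fin (n + 1) → ℝ) ∘ Equiv.Perm.decomposeFin.symm (0, π) := by
  funext i
  refine Fin.cases ?_ (fun i => ?_) i
  · simp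
  · simp [Equiv.Perm.decomposeFin_symm_apply_succ]

/-- `π` maps the complement of `j` onto the complement of `π j`; `κ` is this bijection read through
the `succAbove` enumerations of both. It is the permutation left over when the sum in the creation
operator is reindexed by `π`. -/
lemma exists_perm_succAbove {n : ℕ} (π : Equiv.Perm (Fin (n + 1))) (j : Fin (n + 1)) :
    ∃ κ : Equiv.Perm (Fin n), ∀ i, π (j.succAbove i) = (π j).succAbove (κ i) := by
  refine ⟨(finSuccAboveEquiv j).trans ((π.subtypeEquiv fun x => ?_).trans
    (finSuccAboveEquiv (π j)).symm), fun i => ?_⟩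
  · simp
  · have := (finSuccAboveEquiv (π j)).apply_symm_apply
      ⟨π (j.succAbove i), by simp [Fin.succAbove_ne]⟩
    have h2 := congrArg Subtype.val this
    rw [finSuccAboveEquiv_apply] at h2
    exact h2.symm

namespace IsBosonic

variable {Ψ Φ : FockMap}

lemma add (h : IsBosonic Ψ) (h' : IsBosonic Φ) : IsBosonic fun n ω => Ψ n ω + Φ n ω :=
  fun n π ω => by simp only [h n π ω, h' n π ω]

lemma sub (h : IsBosonic Ψ) (h' : IsBosonic Φ) : IsBosonic fun n ω => Ψ n ω - Φ n ω :=
  fun n π ω => by simp only [h n π ω, h' n π ω]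

lemma mul_left (h : IsBosonic Ψ) (K : Matrix (Fin 2) (Fin 2) ℂ) :
    IsBosonic fun n ω => K * Ψ n ω :=
  fun n π ω => by simp only [h n π ω]

lemma annihilate (h : IsBosonic Ψ) (f : ℝ → ℂ) : IsBosonic (annihilate f Ψ) := by
  intro n π ω
  simp only [SpinBoson.annihilate, cons_comp_perm, h (n + 1)]

lemma create (h : IsBosonic Ψ) (f : ℝ → ℂ) : IsBosonic (create f Ψ) := by
  intro n π ω
  cases n with
  | zero => rfl
  | succ n =>
    simp only [SpinBoson.create]
    congr 1
    rw [← Equiv.sum_comp π fun j => f (ω j) • Ψ n fun i => ω (j.succAbove i)]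
    refine Finset.sum_congr rfl fun j _ => ?_
    obtain ⟨κ, hκ⟩ := exists_perm_succAbove π j
    rw [Function.comp_apply, ← h n κ fun i => ω ((π j).succAbove i)]
    congr 2
    funext i
    simp [hκ]

lemma hamiltonian (h : IsBosonic Ψ) (ω₀ δ : ℝ) (J : ℝ → ℝ) (t : ℝ) :
    IsBosonic (hamiltonian ω₀ δ J t Ψ) :=
  (h.mul_left _).add (((h.annihilate _).add (h.create _)).mul_left _)

end IsBosonic

lemma isBosonic_vacuum : IsBosonic vacuum := fun _ _ _ => rfl

/-! ### Canonical commutation relations -/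

/-- The integral of the product of two couplings over the band. -/
def bandInner (Ω : ℝ) (h f : ℝ → ℂ) : ℂ := ∫ x, starRingEnd ℂ (h x) * f x ∂bandMeasure Ω

section Commutation

variable {Ω M : ℝ} {f h : ℝ → ℝ → ℂ} {Ψ : ℝ → FockMap}

lemma annihilate_mul_left (hh : IsBandFamily Ω M h) (hΨ : RapidFamily Ψ) (s t : ℝ)
    (K : Matrix (Fin 2) (Fin 2) ℂ) (n : ℕ) (ω : Fin n → ℝ) :
    annihilate (h s) (fun n ω => K * Ψ t n ω) n ω = K * annihilate (h s) (Ψ t) n ω := by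
  ext a b
  rw [Matrix.mul_apply]
  simp only [annihilate_apply hh, Matrix.mul_apply, Fin.sum_univ_two, mul_add]
  have e : ∀ c x, starRingEnd ℂ (h s x) * (K a c * Ψ t (n + 1) (Fin.cons x ω) c b) =
      K a c * (starRingEnd ℂ (h s x) * Ψ t (n + 1) (Fin.cons x ω) c b) := fun c x => by ring
  simp only [e]
  rw [integral_add ((hΨ.integrable_mul_cons hh s t n ω 0 b).const_mul _)
    ((hΨ.integrable_mul_cons hh s t n ω 1 b).const_mul _), integral_const_mul, integral_const_mul]
  ring

lemma annihilate_add (hh : IsBandFamily Ω M h) {Φ : ℝ → FockMap} (hΨ : RapidFamily Ψ)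
    (hΦ : RapidFamily Φ) (s t : ℝ) (n : ℕ) (ω : Fin n → ℝ) :
    annihilate (h s) (fun n ω => Ψ t n ω + Φ t n ω) n ω =
      annihilate (h s) (Ψ t) n ω + annihilate (h s) (Φ t) n ω := by
  ext a b
  rw [Matrix.add_apply]
  simp only [annihilate_apply hh, Matrix.add_apply, mul_add]
  rw [integral_add (hΨ.integrable_mul_cons hh s t n ω a b)
    (hΦ.integrable_mul_cons hh s t n ω a b), mul_add]

lemma create_add (f : ℝ → ℂ) (Ψ Φ : FockMap) (n : ℕ) (ω : Fin n → ℝ) :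
    create f (fun n ω => Ψ n ω + Φ n ω) n ω = create f Ψ n ω + create f Φ n ω := by
  cases n with
  | zero => simp [create]
  | succ n => simp [create, Finset.sum_add_distrib, smul_add]

/-- `a(h) a†(f) = a†(f) a(h) + ⟨h, f⟩`. -/
lemma annihilate_create (hh : IsBandFamily Ω M h) (hf : IsBandFamily Ω M f) (hΨ : RapidFamily Ψ)
    (s t u : ℝ) (n : ℕ) (ω : Fin n → ℝ) :
    annihilate (h s) (create (f t) (Ψ u)) n ω =
      create (f t) (annihilate (h s) (Ψ u)) n ω + bandInner Ω (h s) (f t) • Ψ u n ω := by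
  have hint : Integrable (fun x => starRingEnd ℂ (h s x) * f t x) (bandMeasure Ω) := by
    refine Integrable.of_bound (C := M * M) ?_ (Filter.Eventually.of_forall fun x => ?_)
    · exact ((Complex.continuous_conj.measurable.comp (hh.measurable s)).mul
        (hf.measurable t)).aestronglyMeasurable
    · rw [norm_mul, RCLike.norm_conj]
      exact mul_le_mul (hh.norm_le s x) (hf.norm_le t x) (norm_nonneg _) hh.nonneg
  have hsq : ∀ m : ℕ, ((Real.sqrt (m + 1) : ℝ) : ℂ) * ((1 / Real.sqrt (m + 1) : ℝ) : ℂ) = 1 := by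
    intro m
    rw [← Complex.ofReal_mul, mul_one_div_cancel (Real.sqrt_pos.2 (by positivity)).ne']
    simp
  ext a b
  rw [Matrix.add_apply, Matrix.smul_apply, annihilate_apply hh]
  -- The summand `j = 0` creates the very boson that is then annihilated and yields the scalar `⟨h,
  -- f⟩`; the others create a boson of `ω` and yield `a†(f) a(h)`.
  simp only [create_succ_apply, Fin.sum_univ_succ, Fin.cons_zero, Fin.cons_succ,
    Fin.zero_succAbove]
  have e : ∀ x, starRingEnd ℂ (h s x) * (((1 / Real.sqrt (n + 1) : ℝ) : ℂ) *
      (f t x * Ψ u n (fun i => ω i) a b + ∑ j : Fin n, f t (ω j) *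
        Ψ u n (fun i => (Fin.cons x ω : Fin (n + 1) → ℝ) (j.succ.succAbove i)) a b)) =
      ((1 / Real.sqrt (n + 1) : ℝ) : ℂ) * (starRingEnd ℂ (h s x) * f t x * Ψ u n ω a b +
        ∑ j : Fin n, f t (ω j) * (starRingEnd ℂ (h s x) *
          Ψ u n (fun i => (Fin.cons x ω : Fin (n + 1) → ℝ) (j.succ.succAbove i)) a b)) := by
    intro x
    simp only [mul_add, Finset.mul_sum]
    congr 1
    · ring
    · exact Finset.sum_congr rfl fun j _ => by ring
  simp only [e]
  rw [integral_const_mul, ← mul_assoc, hsq, one_mul]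
  cases n with
  | zero => simp [create_zero_apply, bandInner, integral_mul_const]
  | succ n =>
    have ec : ∀ (x : ℝ) (j : Fin (n + 1)),
        (fun i => (Fin.cons x ω : Fin (n + 2) → ℝ) (j.succ.succAbove i)) =
          Fin.cons x fun i => ω (j.succAbove i) := by
      intro x j
      funext i
      refine Fin.cases ?_ (fun i => ?_) i
      · simp
      · simp
    simp only [ec]
    have hi : ∀ j : Fin (n + 1), Integrable (fun x => f t (ω j) * (starRingEnd ℂ (h s x) *
        Ψ u (n + 1) (Fin.cons x fun i => ω (j.succAbove i)) a b)) (bandMeasure Ω) := fun j =>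
      (hΨ.integrable_mul_cons hh s u n _ a b).const_mul _
    rw [integral_add (hint.mul_const _) (integrable_finsetSum _ fun j _ => hi j),
      integral_mul_const, integral_finsetSum _ fun j _ => hi j, create_succ_apply, add_comm]
    congr 1
    simp only [annihilate_apply hh, integral_const_mul, Finset.mul_sum]
    refine Finset.sum_congr rfl fun j _ => ?_
    linear_combination (-(f t (ω j)) * ∫ x, starRingEnd ℂ (h s x) *
      Ψ u (n + 1) (Fin.cons x fun i => ω (j.succAbove i)) a b ∂bandMeasure Ω) * hsq n

/-- `a(h) a(f) = a(f) a(h)` on bosonic amplitudes. -/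
lemma annihilate_comm (hh : IsBandFamily Ω M h) (hf : IsBandFamily Ω M f) (hΨ : RapidFamily Ψ)
    (s t u : ℝ) (hs : IsBosonic (Ψ u)) (n : ℕ) (ω : Fin n → ℝ) :
    annihilate (h s) (annihilate (f t) (Ψ u)) n ω =
      annihilate (f t) (annihilate (h s) (Ψ u)) n ω := by
  ext a b
  -- Bosonic symmetry exchanges the two integrated frequencies; the rest is Fubini.
  have e : ∀ x y, Ψ u (n + 1 + 1) (Fin.cons y (Fin.cons x ω)) =
      Ψ u (n + 1 + 1) (Fin.cons x (Fin.cons y ω)) := by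
    intro x y
    rw [← hs _ (Equiv.swap 0 1)]
    congr 1
    funext i
    refine Fin.cases ?_ (fun i => Fin.cases ?_ (fun i => ?_) i) i
    · rw [Function.comp_apply, Equiv.swap_apply_left]
      rfl
    · rw [Function.comp_apply, Fin.succ_zero_eq_one, Equiv.swap_apply_right]
      rfl
    · rw [Function.comp_apply, Equiv.swap_apply_of_ne_of_ne]
      · simp
      · exact Fin.succ_ne_zero _
      · rw [← Fin.succ_zero_eq_one, Ne, Fin.succ_inj]
        exact Fin.succ_ne_zero _
  rw [annihilate_apply hh, annihilate_apply hf]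
  congr 1
  simp only [annihilate_apply hf, annihilate_apply hh]
  simp only [mul_left_comm (starRingEnd ℂ _) (((Real.sqrt _ : ℝ) : ℂ)), integral_const_mul]
  congr 1
  simp only [← integral_const_mul]
  rw [integral_integral_swap]
  · refine integral_congr_ae (Filter.Eventually.of_forall fun y => integral_congr_ae
      (Filter.Eventually.of_forall fun x => ?_))
    simp only [e x y]
    ring
  · have hcons : Measurable fun c : ℝ × ℝ => (Fin.cons c.1 ω : Fin (n + 1) → ℝ) := by
      refine measurable_pi_lambda _ fun i => ?_
      induction i using Fin.cases with
      | zero => simpa only [Fin.cons_zero] using measurable_fst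
      | succ i => simpa only [Fin.cons_succ] using measurable_const
    obtain ⟨C, hC0, hC⟩ := hΨ.norm_le |u|
    refine Integrable.of_bound (C := M * (M * C)) (Measurable.aestronglyMeasurable ?_)
      (Filter.Eventually.of_forall fun x => ?_)
    · refine (Complex.continuous_conj.measurable.comp
        ((hh.measurable s).comp measurable_fst)).mul
        ((Complex.continuous_conj.measurable.comp
        ((hf.measurable t).comp measurable_snd)).mul ?_)
      exact (hΨ.measurable_cons u (n + 1) a b).comp (hcons.prodMk measurable_snd)
    · simp only [Function.uncurry, norm_mul, RCLike.norm_conj]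
      exact mul_le_mul (hh.norm_le _ _) (mul_le_mul (hf.norm_le _ _) (hC u le_rfl _ _ _ _)
        (norm_nonneg _) hf.nonneg) (by positivity) hf.nonneg

/-- Commuting the annihilation operator past the Hamiltonian. -/
lemma annihilate_hamiltonian {J : ℝ → ℝ} (hh : IsBandFamily Ω M h)
    (hf : IsBandFamily Ω M (coupling J)) (hΨ : RapidFamily Ψ)
    (s t : ℝ) (hs : IsBosonic (Ψ t)) (ω₀ δ : ℝ) (n : ℕ) (ω : Fin n → ℝ) :
    annihilate (h s) (hamiltonian ω₀ δ J t (Ψ t)) n ω =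
      hamiltonian ω₀ δ J t (annihilate (h s) (Ψ t)) n ω +
        bandInner Ω (h s) (coupling J t) • (σx * Ψ t n ω) := by
  have h1 := annihilate_add hh (hΨ.mul_left (systemHamiltonian ω₀ δ))
    (((hΨ.annihilate hf).add (hΨ.create hf)).mul_left σx) s t n ω
  have h2 := annihilate_mul_left hh ((hΨ.annihilate hf).add (hΨ.create hf)) s t σx n ω
  have h3 := annihilate_add hh (hΨ.annihilate hf) (hΨ.create hf) s t n ω
  have h4 := annihilate_mul_left hh hΨ s t (systemHamiltonian ω₀ δ) n ω
  have h5 := annihilate_create hh hf hΨ s t t n ω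
  have h6 := annihilate_comm hh hf hΨ s t t hs n ω
  refine h1.trans ?_
  rw [h2, h3, h4, h5, h6]
  simp only [hamiltonian, mul_add, Matrix.mul_smul, add_assoc]

end Commutation

/-! ### The Dyson series -/

lemma rapidFamily_vacuum : RapidFamily fun _ => vacuum := by
  refine ⟨fun _ n a b => measurable_const, fun _ _ _ _ => continuous_const, fun T r hr =>
    ⟨1, zero_le_one, fun t _ n ω a b => ?_⟩⟩
  rcases n with _ | n
  · fin_cases a <;> fin_cases b <;> simp [vacuum]
  · simp [vacuum]

lemma σx_mul_apply (A : Matrix (Fin 2) (Fin 2) ℂ) (a b : Fin 2) :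
    (σx * A) a b = A (1 - a) b := by
  fin_cases a <;> simp [σx, Matrix.mul_apply, Fin.sum_univ_two]

lemma norm_systemHamiltonian_mul_le (ω₀ δ : ℝ) (A : Matrix (Fin 2) (Fin 2) ℂ) (a b : Fin 2) {C : ℝ}
    (hC : ∀ a b, ‖A a b‖ ≤ C) :
    ‖(systemHamiltonian ω₀ δ * A) a b‖ ≤ (|ω₀ / 2| + |δ|) * C := by
  have e : (systemHamiltonian ω₀ δ * A) a b =
      ((ω₀ / 2 : ℝ) : ℂ) * (σz * A) a b + (δ : ℂ) * A (1 - a) b := by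
    rw [systemHamiltonian, add_mul, Matrix.add_apply, Matrix.smul_mul, Matrix.smul_mul,
      Matrix.smul_apply, Matrix.smul_apply, σx_mul_apply, smul_eq_mul, smul_eq_mul]
  have hz : ‖(σz * A) a b‖ = ‖A a b‖ := by
    fin_cases a <;> simp [σz, Matrix.mul_apply, Fin.sum_univ_two]
  rw [e, add_mul]
  refine (norm_add_le _ _).trans (add_le_add ?_ ?_)
  · rw [norm_mul, Complex.norm_real, Real.norm_eq_abs, hz]
    gcongr
    exact hC _ _
  · rw [norm_mul, Complex.norm_real, Real.norm_eq_abs]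
    gcongr
    exact hC _ _

lemma isBosonic_dysonTerm (ω₀ δ : ℝ) (J : ℝ → ℝ) (k : ℕ) (t : ℝ) :
    IsBosonic (dysonTerm ω₀ δ J k t) := by
  induction k generalizing t with
  | zero => exact isBosonic_vacuum
  | succ k ih =>
    intro n π ω
    simp only [dysonTerm, fun s => (ih s).hamiltonian ω₀ δ J s n π ω]

lemma isBosonic_evolved (ω₀ δ : ℝ) (J : ℝ → ℝ) (t : ℝ) : IsBosonic (evolved ω₀ δ J t) := by
  intro n π ω
  simp only [evolved, fun k => isBosonic_dysonTerm ω₀ δ J k t n π ω]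

/-- The growth constant of the Dyson series. -/
def dysonRate (ω₀ δ Ω M : ℝ) : ℝ := |ω₀ / 2| + |δ| + (M * bandLength Ω + M)

section Dyson

variable {Ω M : ℝ} {J : ℝ → ℝ}

lemma dysonRate_nonneg (hf : IsBandFamily Ω M (coupling J)) (ω₀ δ : ℝ) :
    0 ≤ dysonRate ω₀ δ Ω M := by
  have := hf.nonneg
  have := bandLength_nonneg Ω
  unfold dysonRate
  positivity

/-- With at most `k` bosons present, every nonzero annihilation or creation amplitude carries a
factor at most `√(k + 1)`. The bound is thus uniform in the sector `n`, although the Hamiltonian is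
unbounded. -/
lemma norm_hamiltonian_le (hf : IsBandFamily Ω M (coupling J)) (ω₀ δ : ℝ)
    (t : ℝ) (Ψ : FockMap) {k : ℕ} {C : ℝ}
    (hC : ∀ n ω a b, ‖Ψ n ω a b‖ ≤ C) (hk : ∀ n ω, k < n → Ψ n ω = 0) (n : ℕ) (ω : Fin n → ℝ)
    (a b : Fin 2) :
    ‖hamiltonian ω₀ δ J t Ψ n ω a b‖ ≤ dysonRate ω₀ δ Ω M * (Real.sqrt (k + 1) * C) := by
  have hC0 : 0 ≤ C := (norm_nonneg _).trans (hC 0 0 0 0)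
  have hM := hf.nonneg
  have hL := bandLength_nonneg Ω
  have h1 := norm_systemHamiltonian_mul_le ω₀ δ (Ψ n ω) a b (hC n ω)
  have hs1 : 1 ≤ Real.sqrt (k + 1) := by
    rw [Real.one_le_sqrt]; linarith [Nat.cast_nonneg (α := ℝ) k]
  have h2 : ∀ c, ‖annihilate (coupling J t) Ψ n ω c b‖ ≤
      Real.sqrt (k + 1) * (M * C * bandLength Ω) := by
    intro c
    rcases lt_or_ge k (n + 1) with h | h
    · refine (norm_annihilate_le hf t Ψ n ω c b (C := 0) fun x => by simp [hk _ _ h]).trans ?_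
      simp only [mul_zero, zero_mul]
      positivity
    · refine (norm_annihilate_le hf t Ψ n ω c b fun x => hC _ _ _ _).trans ?_
      gcongr
      exact_mod_cast (Nat.le_succ n).trans h
  have h3 : ∀ c, ‖create (coupling J t) Ψ n ω c b‖ ≤ Real.sqrt (k + 1) * (M * C) := by
    intro c
    cases n with
    | zero => simp only [create_zero_apply, norm_zero]; positivity
    | succ n =>
      rcases lt_or_ge k n with h | h
      · refine (norm_create_succ_le hf t Ψ n ω c b (C := 0) fun x => by simp [hk _ _ h]).trans ?_
        simp only [mul_zero]
        positivity
      · refine (norm_create_succ_le hf t Ψ n ω c b fun x => hC _ _ _ _).trans ?_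
        gcongr
  rw [hamiltonian, Matrix.add_apply, σx_mul_apply, Matrix.add_apply]
  calc _ ≤ (|ω₀ / 2| + |δ|) * C + (Real.sqrt (k + 1) * (M * C * bandLength Ω) +
        Real.sqrt (k + 1) * (M * C)) :=
      (norm_add_le _ _).trans (add_le_add h1 ((norm_add_le _ _).trans (add_le_add (h2 _) (h3 _))))
    _ ≤ (|ω₀ / 2| + |δ|) * (Real.sqrt (k + 1) * C) + (Real.sqrt (k + 1) * (M * C * bandLength Ω) +
        Real.sqrt (k + 1) * (M * C)) := by
      gcongr
      exact le_mul_of_one_le_left hC0 hs1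
    _ = _ := by unfold dysonRate; ring

lemma rapidFamily_dysonTerm (hf : IsBandFamily Ω M (coupling J)) (ω₀ δ : ℝ)
    (k : ℕ) : RapidFamily (dysonTerm ω₀ δ J k) := by
  induction k with
  | zero => exact rapidFamily_vacuum
  | succ k ih => exact ((ih.hamiltonian hf ω₀ δ).timeIntegral).smul _

lemma dysonTerm_eq_zero (hf : IsBandFamily Ω M (coupling J)) (ω₀ δ : ℝ)
    (k : ℕ) (t : ℝ) (n : ℕ) (ω : Fin n → ℝ) (hn : k < n) :
    dysonTerm ω₀ δ J k t n ω = 0 := by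
  induction k generalizing t n with
  | zero => simp [dysonTerm, vacuum, Nat.pos_iff_ne_zero.1 hn]
  | succ k ih =>
    ext a b
    have hH : ∀ s, hamiltonian ω₀ δ J s (dysonTerm ω₀ δ J k s) n ω a b = 0 := by
      intro s
      obtain ⟨n, rfl⟩ : ∃ m, n = m + 1 := ⟨n - 1, by omega⟩
      simp only [hamiltonian, Matrix.add_apply, σx_mul_apply, annihilate_apply hf,
        create_succ_apply, ih s (n + 1) _ (by omega), ih s n _ (by omega),
        ih s (n + 1 + 1) _ (by omega)]
      simp
    simp [dysonTerm, hH]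

/-- One more application of the Hamiltonian costs `√(k + 1)`, while integrating `|s| ^ k` in time
gains `1 / (k + 1)`. The net gain `1 / √(k + 1)` builds up the square root of the factorial. -/
lemma norm_dysonTerm_le (hf : IsBandFamily Ω M (coupling J)) (ω₀ δ : ℝ)
    (k : ℕ) (t : ℝ) (n : ℕ) (ω : Fin n → ℝ) (a b : Fin 2) :
    ‖dysonTerm ω₀ δ J k t n ω a b‖ ≤
      (dysonRate ω₀ δ Ω M * |t|) ^ k / Real.sqrt (k.factorial) := by
  induction k generalizing t n a b with
  | zero =>
    by_cases hn : n = 0 <;> fin_cases a <;> fin_cases b <;> simp [dysonTerm, vacuum, hn]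
  | succ k ih =>
    set K := dysonRate ω₀ δ Ω M
    have hK : 0 ≤ K := dysonRate_nonneg hf ω₀ δ
    have hsq : (0 : ℝ) < Real.sqrt (k + 1) := Real.sqrt_pos.2 (by positivity)
    have hsf : (0 : ℝ) < Real.sqrt k.factorial := Real.sqrt_pos.2 (by positivity)
    have hH : ∀ s, ‖hamiltonian ω₀ δ J s (dysonTerm ω₀ δ J k s) n ω a b‖ ≤
        K * (Real.sqrt (k + 1) * ((K * |s|) ^ k / Real.sqrt k.factorial)) := fun s =>
      norm_hamiltonian_le hf ω₀ δ s _ (ih s) (fun m ω' hm => dysonTerm_eq_zero hf ω₀ δ k s m ω' hm)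
        n ω a b
    have h1 : ‖dysonTerm ω₀ δ J (k + 1) t n ω a b‖ =
        ‖∫ s in (0 : ℝ)..t, hamiltonian ω₀ δ J s (dysonTerm ω₀ δ J k s) n ω a b‖ := by
      simp [dysonTerm]
    rw [h1]
    have hi := ((((rapidFamily_dysonTerm hf ω₀ δ k).hamiltonian hf ω₀ δ).continuous n ω a
      b).norm.intervalIntegrable (μ := volume) 0 t).def'
    have h2 : ∀ s, K * (Real.sqrt (k + 1) * ((K * |s|) ^ k / Real.sqrt k.factorial)) =
        K ^ (k + 1) * Real.sqrt (k + 1) / Real.sqrt k.factorial * |s - 0| ^ k := by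
      intro s; rw [sub_zero, mul_pow]; ring
    have hc : Continuous fun s : ℝ =>
        K * (Real.sqrt (k + 1) * ((K * |s|) ^ k / Real.sqrt k.factorial)) := by fun_prop
    calc _ ≤ ∫ s in Set.uIoc 0 t, ‖hamiltonian ω₀ δ J s (dysonTerm ω₀ δ J k s) n ω a b‖ :=
          intervalIntegral.norm_integral_le_integral_norm_uIoc
      _ ≤ ∫ s in Set.uIoc 0 t,
          K * (Real.sqrt (k + 1) * ((K * |s|) ^ k / Real.sqrt k.factorial)) :=
        setIntegral_mono hi (hc.intervalIntegrable 0 t).def' hH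
      _ = K ^ (k + 1) * Real.sqrt (k + 1) / Real.sqrt k.factorial *
          (|t| ^ (k + 1) / (k + 1)) := by
        simp only [h2]
        rw [integral_const_mul, integral_pow_abs_sub_uIoc, sub_zero]
      _ = _ := by
        rw [Nat.factorial_succ, Nat.cast_mul, Real.sqrt_mul (by positivity), mul_pow]
        push_cast
        field_simp
        rw [Real.sq_sqrt (by positivity)]

/-- Bosons arise only through the coupling, which vanishes off the band, and annihilating others
does not alter the boson `i`. This allows integrals over all frequencies to be restricted to the
band. -/
lemma dysonTerm_eq_zero_of_notMem (hf : IsBandFamily Ω M (coupling J)) (ω₀ δ : ℝ)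
    (k : ℕ) (t : ℝ) (n : ℕ) (ω : Fin n → ℝ) (i : Fin n)
    (hi : ω i ∉ Set.Icc 0 Ω) : dysonTerm ω₀ δ J k t n ω = 0 := by
  induction k generalizing t n with
  | zero =>
    have : n ≠ 0 := by rintro rfl; exact i.elim0
    simp [dysonTerm, vacuum, this]
  | succ k ih =>
    ext a b
    have hH : ∀ s, hamiltonian ω₀ δ J s (dysonTerm ω₀ δ J k s) n ω a b = 0 := by
      intro s
      obtain ⟨n, rfl⟩ : ∃ m, n = m + 1 :=
        ⟨n - 1, by have : n ≠ 0 := by { rintro rfl; exact i.elim0 }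
                   omega⟩
      have hc : ∀ j : Fin (n + 1), coupling J s (ω j) *
          dysonTerm ω₀ δ J k s n (fun i => ω (j.succAbove i)) (1 - a) b = 0 := by
        intro j
        rcases eq_or_ne i j with rfl | hij
        · rw [hf.eq_zero s _ hi, zero_mul]
        · obtain ⟨l, rfl⟩ := Fin.exists_succAbove_eq hij
          rw [ih s n _ l hi, Matrix.zero_apply, mul_zero]
      have ha : ∀ x, dysonTerm ω₀ δ J k s (n + 1 + 1) (Fin.cons x ω) = 0 := fun x =>
        ih s _ _ i.succ (by simpa using hi)
      simp only [hamiltonian, Matrix.add_apply, σx_mul_apply, annihilate_apply hf,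
        create_succ_apply, ih s (n + 1) _ i hi, ha, hc]
      simp
    simp [dysonTerm, hH]

end Dyson

/-- Split `x ^ k / √k!` as `((2 * x) ^ k / √k!) * (1 / 2) ^ k`; a product is at most the sum of the
squares, here an exponential and a geometric series. -/
lemma summable_pow_div_sqrt_factorial (x : ℝ) (hx : 0 ≤ x) :
    Summable fun k : ℕ => x ^ k / Real.sqrt k.factorial := by
  have h1 : Summable fun k : ℕ => ((4 * x ^ 2) ^ k / k.factorial + (1 / 4 : ℝ) ^ k) :=
    (Real.summable_pow_div_factorial _).add
      (summable_geometric_of_lt_one (by norm_num) (by norm_num))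
  refine h1.of_nonneg_of_le (fun k => by positivity) fun k => ?_
  have hs : (0 : ℝ) < Real.sqrt k.factorial := Real.sqrt_pos.2 (by positivity)
  have e1 : (4 * x ^ 2) ^ k / k.factorial = ((2 * x) ^ k / Real.sqrt k.factorial) ^ 2 := by
    rw [div_pow, Real.sq_sqrt (by positivity), ← pow_mul, mul_comm k 2, pow_mul]
    congr 2
    ring
  have e2 : (1 / 4 : ℝ) ^ k = ((1 / 2) ^ k) ^ 2 := by
    rw [← pow_mul, mul_comm k 2, pow_mul]; norm_num
  have e3 : x ^ k / Real.sqrt k.factorial =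
      (2 * x) ^ k / Real.sqrt k.factorial * (1 / 2) ^ k := by
    rw [div_mul_eq_mul_div, ← mul_pow]
    congr 2
    ring
  rw [e1, e2, e3]
  nlinarith [sq_nonneg ((2 * x) ^ k / Real.sqrt k.factorial - (1 / 2) ^ k),
    sq_nonneg ((2 * x) ^ k / Real.sqrt k.factorial + (1 / 2) ^ k)]

lemma hasSum_mul_left_apply {A : ℕ → Matrix (Fin 2) (Fin 2) ℂ} {B : Matrix (Fin 2) (Fin 2) ℂ}
    (h : ∀ a b, HasSum (fun k => A k a b) (B a b)) (K : Matrix (Fin 2) (Fin 2) ℂ) (a b : Fin 2) :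
    HasSum (fun k => (K * A k) a b) ((K * B) a b) := by
  simp only [Matrix.mul_apply]
  exact hasSum_sum fun c _ => (h c b).mul_left _

/-- The Hamiltonian may be applied to a dominated series termwise. -/
lemma hasSum_hamiltonian {Ω M : ℝ} {J : ℝ → ℝ} (hf : IsBandFamily Ω M (coupling J)) (ω₀ δ t : ℝ)
    {Ψ : ℕ → ℝ → FockMap} (hΨ : ∀ k, RapidFamily (Ψ k)) {Φ : FockMap} {u : ℕ → ℝ}
    (hu : Summable u) (hb : ∀ k n ω a b, ‖Ψ k t n ω a b‖ ≤ u k)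
    (hs : ∀ n ω a b, HasSum (fun k => Ψ k t n ω a b) (Φ n ω a b))
    (n : ℕ) (ω : Fin n → ℝ) (a b : Fin 2) :
    HasSum (fun k => hamiltonian ω₀ δ J t (Ψ k t) n ω a b)
      (hamiltonian ω₀ δ J t Φ n ω a b) := by
  have hM := hf.nonneg
  have ha : ∀ a b, HasSum (fun k => annihilate (coupling J t) (Ψ k t) n ω a b)
      (annihilate (coupling J t) Φ n ω a b) := by
    intro a b
    simp only [annihilate_apply hf]
    refine HasSum.mul_left _ ?_
    have hsum : Summable fun k => ∫ x, ‖starRingEnd ℂ (coupling J t x) *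
        Ψ k t (n + 1) (Fin.cons x ω) a b‖ ∂bandMeasure Ω := by
      refine (hu.mul_left (M * bandLength Ω)).of_nonneg_of_le
        (fun k => integral_nonneg fun _ => norm_nonneg _) fun k => ?_
      refine (integral_mono ((hΨ k).integrable_mul_cons hf t t n ω a b).norm
        (integrable_const (M * u k)) fun x => ?_).trans (le_of_eq ?_)
      · simp only [norm_mul, RCLike.norm_conj]
        exact mul_le_mul (hf.norm_le t x) (hb _ _ _ _ _) (norm_nonneg _) hM
      · rw [integral_const, smul_eq_mul, bandLength]
        ring
    have h1 := hasSum_integral_of_summable_integral_norm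
      (fun k => (hΨ k).integrable_mul_cons hf t t n ω a b) hsum
    have h2 : ∀ x, ∑' k, starRingEnd ℂ (coupling J t x) * Ψ k t (n + 1) (Fin.cons x ω) a b =
        starRingEnd ℂ (coupling J t x) * Φ (n + 1) (Fin.cons x ω) a b := fun x =>
      ((hs (n + 1) (Fin.cons x ω) a b).mul_left _).tsum_eq
    simpa only [h2] using h1
  have hc : ∀ a b, HasSum (fun k => create (coupling J t) (Ψ k t) n ω a b)
      (create (coupling J t) Φ n ω a b) := by
    intro a b
    cases n with
    | zero => simp only [create_zero_apply]; exact hasSum_zero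
    | succ n =>
      simp only [create_succ_apply]
      exact (hasSum_sum fun j _ => (hs _ _ _ _).mul_left _).mul_left _
  simp only [hamiltonian, Matrix.add_apply]
  exact (hasSum_mul_left_apply (hs n ω) _ a b).add
    (hasSum_mul_left_apply (fun a b => (ha a b).add (hc a b)) _ a b)

section Evolved

variable {Ω M : ℝ} {J : ℝ → ℝ}

lemma summable_dysonTerm (hf : IsBandFamily Ω M (coupling J)) (ω₀ δ : ℝ)
    (t : ℝ) (n : ℕ) (ω : Fin n → ℝ) :
    Summable fun k => dysonTerm ω₀ δ J k t n ω := by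
  refine Pi.summable.2 fun a => Pi.summable.2 fun b => ?_
  refine Summable.of_norm_bounded (summable_pow_div_sqrt_factorial (dysonRate ω₀ δ Ω M * |t|)
    (mul_nonneg (dysonRate_nonneg hf ω₀ δ) (abs_nonneg t))) fun k => ?_
  exact norm_dysonTerm_le hf ω₀ δ k t n ω a b

lemma hasSum_dysonTerm (hf : IsBandFamily Ω M (coupling J)) (ω₀ δ : ℝ)
    (t : ℝ) (n : ℕ) (ω : Fin n → ℝ) (a b : Fin 2) :
    HasSum (fun k => dysonTerm ω₀ δ J k t n ω a b) (evolved ω₀ δ J t n ω a b) :=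
  Pi.hasSum.1 (Pi.hasSum.1 (summable_dysonTerm hf ω₀ δ t n ω).hasSum a) b

lemma evolved_zero (hf : IsBandFamily Ω M (coupling J)) (ω₀ δ : ℝ)
    (n : ℕ) (ω : Fin n → ℝ) : evolved ω₀ δ J 0 n ω = vacuum n ω := by
  ext a b
  refine (hasSum_dysonTerm hf ω₀ δ 0 n ω a b).unique ?_
  refine hasSum_single (f := fun k => dysonTerm ω₀ δ J k 0 n ω a b) 0 fun k hk => ?_
  obtain ⟨k, rfl⟩ := Nat.exists_eq_succ_of_ne_zero hk
  simp [dysonTerm]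

lemma evolved_eq_zero_of_notMem (hf : IsBandFamily Ω M (coupling J)) (ω₀ δ : ℝ)
    (t : ℝ) (n : ℕ) (ω : Fin n → ℝ) (i : Fin n)
    (hi : ω i ∉ Set.Icc 0 Ω) : evolved ω₀ δ J t n ω = 0 := by
  simp only [evolved, fun k => dysonTerm_eq_zero_of_notMem hf ω₀ δ k t n ω i hi, tsum_zero]

/-- The evolved state solves the Schrödinger equation, amplitude by amplitude. -/
lemma hasDerivAt_evolved (hf : IsBandFamily Ω M (coupling J)) (ω₀ δ : ℝ)
    (t : ℝ) (n : ℕ) (ω : Fin n → ℝ) (a b : Fin 2) :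
    HasDerivAt (fun t => evolved ω₀ δ J t n ω a b)
      (-Complex.I * hamiltonian ω₀ δ J t (evolved ω₀ δ J t) n ω a b) t := by
  set K := dysonRate ω₀ δ Ω M with hKdef
  have hK : 0 ≤ K := dysonRate_nonneg hf ω₀ δ
  set T := |t| + 1
  have hT : 0 ≤ T := by positivity
  -- The derivative of term `k + 1` is the Hamiltonian applied to term `k`, so the differentiated
  -- series is the Hamiltonian series shifted by one, with first term zero.
  let g' : ℕ → ℝ → ℂ := fun k s => match k with
    | 0 => 0
    | k + 1 => -Complex.I * hamiltonian ω₀ δ J s (dysonTerm ω₀ δ J k s) n ω a b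
  let u : ℕ → ℝ := fun k => match k with
    | 0 => 0
    | k + 1 => K * ((2 * (K * T)) ^ k / Real.sqrt k.factorial)
  have hu : Summable u := (summable_nat_add_iff 1).1
    ((summable_pow_div_sqrt_factorial (2 * (K * T)) (by positivity)).mul_left K)
  have hder : ∀ k s, HasDerivAt (fun s => dysonTerm ω₀ δ J k s n ω a b) (g' k s) s := by
    intro k s
    cases k with
    | zero => exact hasDerivAt_const s _
    | succ k =>
      have hc := ((rapidFamily_dysonTerm hf ω₀ δ k).hamiltonian hf ω₀ δ).continuous n ω a b
      exact (hc.integral_hasStrictDerivAt 0 s).hasDerivAt.const_mul (-Complex.I)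
  have hbd : ∀ k s, s ∈ Metric.ball (0 : ℝ) T → ‖g' k s‖ ≤ u k := by
    intro k s hs
    have hs' : |s| ≤ T := (by simpa using hs : |s| < T).le
    cases k with
    | zero => simp [g', u]
    | succ k =>
      have h1 := norm_hamiltonian_le hf ω₀ δ s _ (norm_dysonTerm_le hf ω₀ δ k s)
        (fun m ω' hm => dysonTerm_eq_zero hf ω₀ δ k s m ω' hm) n ω a b
      calc ‖g' (k + 1) s‖ = ‖hamiltonian ω₀ δ J s (dysonTerm ω₀ δ J k s) n ω a b‖ := by simp [g']
        _ ≤ K * (Real.sqrt (k + 1) * ((K * |s|) ^ k / Real.sqrt k.factorial)) := h1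
        _ ≤ K * (2 ^ k * ((K * T) ^ k / Real.sqrt k.factorial)) := by
          gcongr
          exact sqrt_succ_le_two_pow k
        _ = u (k + 1) := by simp only [u]; rw [mul_pow 2]; ring
  have ht : t ∈ Metric.ball (0 : ℝ) T := by simp [T]
  -- Termwise differentiation on the ball of radius `|t| + 1`, where the derivatives have the
  -- summable majorant `u`.
  have h := hasDerivAt_tsum_of_isPreconnected hu Metric.isOpen_ball
    (convex_ball (0 : ℝ) T).isPreconnected (fun k s _ => hder k s) hbd ht
    (hasSum_dysonTerm hf ω₀ δ t n ω a b).summable ht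
  have e1 : (fun s => ∑' k, dysonTerm ω₀ δ J k s n ω a b) = fun s => evolved ω₀ δ J s n ω a b :=
    funext fun s => (hasSum_dysonTerm hf ω₀ δ s n ω a b).tsum_eq
  have e2 : ∑' k, g' k t = -Complex.I * hamiltonian ω₀ δ J t (evolved ω₀ δ J t) n ω a b := by
    have hs := hasSum_hamiltonian hf ω₀ δ t (rapidFamily_dysonTerm hf ω₀ δ)
      (summable_pow_div_sqrt_factorial (K * |t|) (by positivity))
      (fun k n ω a b => norm_dysonTerm_le hf ω₀ δ k t n ω a b)
      (fun n ω a b => hasSum_dysonTerm hf ω₀ δ t n ω a b) n ω a b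
    refine HasSum.tsum_eq ((hasSum_nat_add_iff' (f := fun k => g' k t) 1).1 ?_)
    simpa [g'] using hs.mul_left (-Complex.I)
  rwa [e1, e2] at h

/-- Only Dyson terms with `k ≥ n` reach the sector `n`, and there `r ^ n ≤ (r + 1) ^ k`. The weight
is absorbed by the series, which converges for every argument. -/
lemma rapidFamily_evolved (hf : IsBandFamily Ω M (coupling J)) (ω₀ δ : ℝ) :
    RapidFamily (evolved ω₀ δ J) := by
  refine ⟨fun t n a b => ?_, fun n ω a b => continuous_iff_continuousAt.2 fun t =>
    (hasDerivAt_evolved hf ω₀ δ t n ω a b).continuousAt, fun T r hr => ?_⟩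
  · refine measurable_of_tendsto_metrizable (f := fun (N : ℕ) ω =>
      ∑ k ∈ Finset.range N, dysonTerm ω₀ δ J k t n ω a b) (fun N =>
      Finset.measurable_fun_sum _ fun k _ => (rapidFamily_dysonTerm hf ω₀ δ k).measurable t n a b)
      (tendsto_pi_nhds.2 fun ω => (hasSum_dysonTerm hf ω₀ δ t n ω a b).tendsto_sum_nat)
  · set K := dysonRate ω₀ δ Ω M with hKdef
    have hK : 0 ≤ K := dysonRate_nonneg hf ω₀ δ
    have hsum := summable_pow_div_sqrt_factorial ((r + 1) * (K * |T|)) (by positivity)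
    refine ⟨∑' k : ℕ, ((r + 1) * (K * |T|)) ^ k / Real.sqrt k.factorial,
      tsum_nonneg fun k => by positivity, fun t ht n ω a b => ?_⟩
    have ht' : |t| ≤ |T| := ht.trans (le_abs_self T)
    have h1 : ‖(r : ℂ) ^ n * evolved ω₀ δ J t n ω a b‖ ≤
        ∑' k : ℕ, ((r + 1) * (K * |T|)) ^ k / Real.sqrt k.factorial := by
      rw [← ((hasSum_dysonTerm hf ω₀ δ t n ω a b).mul_left ((r : ℂ) ^ n)).tsum_eq]
      refine tsum_of_norm_bounded hsum.hasSum fun k => ?_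
      rcases lt_or_ge k n with h | h
      · rw [dysonTerm_eq_zero hf ω₀ δ k t n ω h]
        simp only [Matrix.zero_apply, mul_zero, norm_zero]
        positivity
      · rw [norm_mul, norm_pow, Complex.norm_real, Real.norm_of_nonneg hr, mul_pow, mul_div_assoc]
        refine mul_le_mul ?_ ((norm_dysonTerm_le hf ω₀ δ k t n ω a b).trans ?_) (norm_nonneg _)
          (by positivity)
        · exact (pow_le_pow_left₀ hr (by linarith) n).trans
            (pow_le_pow_right₀ (by linarith) h)
        · gcongr
    rwa [norm_mul, norm_pow, Complex.norm_real, Real.norm_of_nonneg hr] at h1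

end Evolved

/-! ### The Fock space inner product -/

/-- Boson configurations: the number of bosons and their frequencies. -/
abbrev BosonConfig := (n : ℕ) × (Fin n → ℝ)

/-- Lebesgue measure on the boson configurations with frequencies in the band. -/
def fockMeasure (Ω : ℝ) : Measure BosonConfig :=
  Measure.sum fun n => (Measure.pi fun _ : Fin n => bandMeasure Ω).map (Sigma.mk n)

lemma measurable_sigmaMk (n : ℕ) : Measurable fun ω : Fin n → ℝ => (⟨n, ω⟩ : BosonConfig) :=
  measurable_iff_le_map.2 (iInf_le _ n)

lemma measurable_bosonConfig {β : Type*} [MeasurableSpace β] {F : BosonConfig → β}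
    (hF : ∀ n, Measurable fun ω : Fin n → ℝ => F ⟨n, ω⟩) : Measurable F := fun _ hs =>
  MeasurableSpace.measurableSet_iInf.2 fun n => hF n hs

/-- The sector `n` has mass `L ^ n`, with `L` the band length; decay at rate `2 * L + 1` leaves at
most `C * (1 / 2) ^ n` per sector. -/
lemma integrable_fockMeasure {Ω C : ℝ} {F : BosonConfig → ℂ} (hF : Measurable F)
    (hC : ∀ n ω, (2 * bandLength Ω + 1) ^ n * ‖F ⟨n, ω⟩‖ ≤ C) :
    Integrable F (fockMeasure Ω) := by
  set L := bandLength Ω with hLdef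
  have hL : 0 ≤ L := bandLength_nonneg Ω
  have hC0 : 0 ≤ C := le_trans (by positivity) (hC 0 0)
  have hb : ∀ n ω, ‖F ⟨n, ω⟩‖ ≤ C / (2 * L + 1) ^ n := fun n ω => by
    rw [le_div_iff₀ (by positivity), mul_comm]; exact hC n ω
  have hi : ∀ n, Integrable (fun ω : Fin n → ℝ => F ⟨n, ω⟩)
      (Measure.pi fun _ : Fin n => bandMeasure Ω) := fun n =>
    Integrable.of_bound (hF.comp (measurable_sigmaMk n)).aestronglyMeasurable
      (C / (2 * L + 1) ^ n) (Filter.Eventually.of_forall fun ω => hb n ω)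
  have hmass : ∀ n : ℕ, (Measure.pi fun _ : Fin n => bandMeasure Ω).real Set.univ = L ^ n := by
    intro n
    simp [measureReal_def, Measure.pi_univ, hLdef, bandLength]
  refine integrable_sum_measure (fun n => ?_) ?_
  · exact (integrable_map_measure hF.aestronglyMeasurable (measurable_sigmaMk n).aemeasurable).2
      (hi n)
  · refine ((summable_geometric_of_lt_one (r := (1 / 2 : ℝ)) (by norm_num)
      (by norm_num)).mul_left C).of_nonneg_of_le
      (fun n => integral_nonneg fun _ => norm_nonneg _) fun n => ?_
    rw [integral_map (measurable_sigmaMk n).aemeasurable hF.norm.aestronglyMeasurable]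
    calc ∫ ω : Fin n → ℝ, ‖F ⟨n, ω⟩‖ ∂(Measure.pi fun _ : Fin n => bandMeasure Ω)
        ≤ ∫ ω : Fin n → ℝ, C / (2 * L + 1) ^ n ∂(Measure.pi fun _ : Fin n => bandMeasure Ω) :=
          integral_mono (hi n).norm (integrable_const _) (hb n)
      _ = C * (L / (2 * L + 1)) ^ n := by
          rw [integral_const, hmass, smul_eq_mul, div_pow]; ring
      _ ≤ C * (1 / 2) ^ n := by
          have h : L / (2 * L + 1) ≤ 1 / 2 := by
            rw [div_le_div_iff₀ (by positivity) (by norm_num)]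
            linarith
          gcongr

lemma hasSum_integral_fockMeasure {Ω : ℝ} {F : BosonConfig → ℂ} (hm : Measurable F)
    (hF : Integrable F (fockMeasure Ω)) :
    HasSum (fun n => ∫ ω : Fin n → ℝ, F ⟨n, ω⟩ ∂(Measure.pi fun _ : Fin n => bandMeasure Ω))
      (∫ x, F x ∂fockMeasure Ω) := by
  have h := hasSum_integral_measure hF
  simp only [integral_map (measurable_sigmaMk _).aemeasurable hm.aestronglyMeasurable] at h
  exact h

/-- The integral of a product of two amplitudes. -/
def pairing (Ω : ℝ) (Φ Ψ : FockMap) (a c b d : Fin 2) : ℂ :=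
  ∫ x : BosonConfig, Ψ x.1 x.2 a c * starRingEnd ℂ (Φ x.1 x.2 b d) ∂fockMeasure Ω

section Pairing

variable {Ψ Φ : ℝ → FockMap}

lemma RapidFamily.measurable_config (hΨ : RapidFamily Ψ) (t : ℝ) (a b : Fin 2) :
    Measurable fun x : BosonConfig => Ψ t x.1 x.2 a b :=
  measurable_bosonConfig fun n => hΨ.measurable t n a b

lemma RapidFamily.measurable_mul_conj (hΨ : RapidFamily Ψ) (hΦ : RapidFamily Φ) (s t : ℝ)
    (a c b d : Fin 2) :
    Measurable fun x : BosonConfig => Ψ t x.1 x.2 a c * starRingEnd ℂ (Φ s x.1 x.2 b d) :=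
  (hΨ.measurable_config t a c).mul
    (Complex.continuous_conj.measurable.comp (hΦ.measurable_config s b d))

lemma RapidFamily.bound_mul_conj (hΨ : RapidFamily Ψ) (hΦ : RapidFamily Φ) (T r : ℝ) (hr : 0 ≤ r) :
    ∃ C, 0 ≤ C ∧ ∀ s t, |s| ≤ T → |t| ≤ T → ∀ n ω a c b d,
      r ^ n * ‖Ψ t n ω a c * starRingEnd ℂ (Φ s n ω b d)‖ ≤ C := by
  obtain ⟨C, hC0, hC⟩ := hΨ.bound T r hr
  obtain ⟨D, hD0, hD⟩ := hΦ.norm_le T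
  refine ⟨C * D, by positivity, fun s t hs ht n ω a c b d => ?_⟩
  rw [norm_mul, RCLike.norm_conj, ← mul_assoc]
  exact mul_le_mul (hC t ht n ω a c) (hD s hs n ω b d) (norm_nonneg _) hC0

lemma RapidFamily.integrable_mul_conj (hΨ : RapidFamily Ψ) (hΦ : RapidFamily Φ) (Ω s t : ℝ)
    (a c b d : Fin 2) :
    Integrable (fun x : BosonConfig => Ψ t x.1 x.2 a c * starRingEnd ℂ (Φ s x.1 x.2 b d))
      (fockMeasure Ω) := by
  have hL := bandLength_nonneg Ω
  obtain ⟨C, -, hC⟩ := hΨ.bound_mul_conj hΦ (max |s| |t|) (2 * bandLength Ω + 1) (by positivity)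
  exact integrable_fockMeasure (hΨ.measurable_mul_conj hΦ s t a c b d) fun n ω =>
    hC s t (le_max_left _ _) (le_max_right _ _) n ω a c b d

lemma hasDerivAt_pairing (hΨ : RapidFamily Ψ) (hΦ : RapidFamily Φ) {Ψ' Φ' : ℝ → FockMap}
    (hΨ' : RapidFamily Ψ') (hΦ' : RapidFamily Φ')
    (hdΨ : ∀ t n ω a b, HasDerivAt (fun t => Ψ t n ω a b) (Ψ' t n ω a b) t)
    (hdΦ : ∀ t n ω a b, HasDerivAt (fun t => Φ t n ω a b) (Φ' t n ω a b) t)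
    (Ω t : ℝ) (a c b d : Fin 2) :
    HasDerivAt (fun t => pairing Ω (Φ t) (Ψ t) a c b d)
      (pairing Ω (Φ t) (Ψ' t) a c b d + pairing Ω (Φ' t) (Ψ t) a c b d) t := by
  have hL := bandLength_nonneg Ω
  set r := 2 * bandLength Ω + 1 with hr
  obtain ⟨C, hC0, hC⟩ := hΨ'.bound_mul_conj hΦ (|t| + 1) r (by positivity)
  obtain ⟨D, hD0, hD⟩ := hΨ.bound_mul_conj hΦ' (|t| + 1) r (by positivity)
  -- The dominating function depends on the boson number alone; its integrability is obtained from
  -- the complex-valued criterion.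
  have hbi : Integrable (fun x : BosonConfig => (((C + D) / r ^ x.1 : ℝ) : ℂ)) (fockMeasure Ω) := by
    refine integrable_fockMeasure (C := C + D) (measurable_bosonConfig fun n => by
      simpa only using measurable_const) fun n ω => ?_
    have hp : 0 < r ^ n := by positivity
    rw [Complex.norm_real, Real.norm_of_nonneg (by positivity), ← hr, mul_div_cancel₀ _ hp.ne']
  have hbi' : Integrable (fun x : BosonConfig => (C + D) / r ^ x.1) (fockMeasure Ω) := by
    exact_mod_cast hbi.re
  have key := hasDerivAt_integral_of_dominated_loc_of_deriv_le (μ := fockMeasure Ω) (x₀ := t)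
    (F := fun t (x : BosonConfig) => Ψ t x.1 x.2 a c * starRingEnd ℂ (Φ t x.1 x.2 b d))
    (F' := fun t x => Ψ' t x.1 x.2 a c * starRingEnd ℂ (Φ t x.1 x.2 b d) +
      Ψ t x.1 x.2 a c * starRingEnd ℂ (Φ' t x.1 x.2 b d))
    (Metric.ball_mem_nhds t one_pos)
    (Filter.Eventually.of_forall fun s => (hΨ.integrable_mul_conj hΦ Ω s s a c b d).1)
    (hΨ.integrable_mul_conj hΦ Ω t t a c b d)
    ((hΨ'.integrable_mul_conj hΦ Ω t t a c b d).add (hΨ.integrable_mul_conj hΦ' Ω t t a c b d)).1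
    (Filter.Eventually.of_forall fun x s hs => ?_) hbi'
    (Filter.Eventually.of_forall fun x s _ => ?_)
  · have h2 := key.2
    rw [integral_add (hΨ'.integrable_mul_conj hΦ Ω t t a c b d)
      (hΨ.integrable_mul_conj hΦ' Ω t t a c b d)] at h2
    exact h2
  · have hs' : |s| ≤ |t| + 1 := by
      rw [Metric.mem_ball, Real.dist_eq] at hs
      linarith [abs_sub_abs_le_abs_sub s t]
    rw [le_div_iff₀ (by positivity), mul_comm]
    calc _ ≤ r ^ x.1 * (‖Ψ' s x.1 x.2 a c * starRingEnd ℂ (Φ s x.1 x.2 b d)‖ +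
          ‖Ψ s x.1 x.2 a c * starRingEnd ℂ (Φ' s x.1 x.2 b d)‖) := by
          gcongr; exact norm_add_le _ _
      _ ≤ C + D := by
          rw [mul_add]
          exact add_le_add (hC s s hs' hs' _ _ _ _ _ _) (hD s s hs' hs' _ _ _ _ _ _)
  · exact (hdΨ s x.1 x.2 a c).mul (hdΦ s x.1 x.2 b d).star

lemma pairing_conj (Ω : ℝ) (Φ Ψ : FockMap) (a c b d : Fin 2) :
    starRingEnd ℂ (pairing Ω Φ Ψ a c b d) = pairing Ω Ψ Φ b d a c := by
  rw [pairing, ← integral_conj, pairing]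
  congr 1
  funext x
  simp [mul_comm]

/-- By symmetry of `Ψ` any frequency `ω j` may be moved to the front, so all `n + 1` terms of the
creation operator have the same integral `I`. The weights then agree: `(n + 1) / √(n + 1) = √(n +
1)`. -/
lemma integral_annihilate_eq_integral_create {Ω M : ℝ} {f : ℝ → ℝ → ℂ} (hf : IsBandFamily Ω M f)
    (hΨ : RapidFamily Ψ) (hΦ : RapidFamily Φ) (s t u : ℝ) (hs : IsBosonic (Ψ t))
    (a c b d : Fin 2) (n : ℕ) :
    ∫ ω : Fin n → ℝ, annihilate (f u) (Ψ t) n ω a c * starRingEnd ℂ (Φ s n ω b d)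
        ∂(Measure.pi fun _ : Fin n => bandMeasure Ω) =
      ∫ ω : Fin (n + 1) → ℝ, Ψ t (n + 1) ω a c *
        starRingEnd ℂ (create (f u) (Φ s) (n + 1) ω b d)
        ∂(Measure.pi fun _ : Fin (n + 1) => bandMeasure Ω) := by
  let G : ℝ × (Fin n → ℝ) → ℂ := fun p => Ψ t (n + 1) (Fin.cons p.1 p.2) a c *
    (starRingEnd ℂ (f u p.1) * starRingEnd ℂ (Φ s n p.2 b d))
  have hGm : Measurable G :=
    ((hΨ.measurable_cons t n a c).comp measurable_swap).mul
      ((Complex.continuous_conj.measurable.comp ((hf.measurable u).comp measurable_fst)).mul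
        (Complex.continuous_conj.measurable.comp ((hΦ.measurable s n b d).comp measurable_snd)))
  obtain ⟨C, hC0, hC⟩ := hΨ.norm_le |t|
  obtain ⟨D, hD0, hD⟩ := hΦ.norm_le |s|
  have hGi : Integrable G ((bandMeasure Ω).prod (Measure.pi fun _ : Fin n => bandMeasure Ω)) := by
    refine Integrable.of_bound (C := C * (M * D)) hGm.aestronglyMeasurable
      (Filter.Eventually.of_forall fun p => ?_)
    simp only [G, norm_mul, RCLike.norm_conj]
    exact mul_le_mul (hC t le_rfl _ _ _ _) (mul_le_mul (hf.norm_le _ _) (hD s le_rfl _ _ _ _)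
      (norm_nonneg _) hf.nonneg) (by positivity) hC0
  set I := ∫ p, G p ∂((bandMeasure Ω).prod (Measure.pi fun _ : Fin n => bandMeasure Ω)) with hI
  have hleft : ∫ ω : Fin n → ℝ, annihilate (f u) (Ψ t) n ω a c * starRingEnd ℂ (Φ s n ω b d)
      ∂(Measure.pi fun _ : Fin n => bandMeasure Ω) = ((Real.sqrt (n + 1) : ℝ) : ℂ) * I := by
    rw [hI, integral_prod_symm _ hGi, ← integral_const_mul]
    congr 1
    funext ω
    rw [annihilate_apply hf, mul_assoc, ← integral_mul_const]
    congr 2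
    funext x
    simp only [G]
    ring
  have hpt : ∀ (j : Fin (n + 1)) (ω : Fin (n + 1) → ℝ), Ψ t (n + 1) ω a c *
      (starRingEnd ℂ (f u (ω j)) * starRingEnd ℂ (Φ s n (fun i => ω (j.succAbove i)) b d)) =
      G (MeasurableEquiv.piFinSuccAbove (fun _ => ℝ) j ω) := by
    intro j ω
    have h1 : Ψ t (n + 1) (Fin.cons (ω j) (j.removeNth ω)) = Ψ t (n + 1) ω := by
      rw [Fin.cons_removeNth_eq_comp_cycleRange_symm, hs]
    change _ = Ψ t (n + 1) (Fin.cons (ω j) (j.removeNth ω)) a c * _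
    rw [h1]
    rfl
  have hterm : ∀ j : Fin (n + 1), ∫ ω : Fin (n + 1) → ℝ, Ψ t (n + 1) ω a c *
      (starRingEnd ℂ (f u (ω j)) * starRingEnd ℂ (Φ s n (fun i => ω (j.succAbove i)) b d))
      ∂(Measure.pi fun _ : Fin (n + 1) => bandMeasure Ω) = I := by
    intro j
    simp only [hpt]
    exact (measurePreserving_piFinSuccAbove (fun _ : Fin (n + 1) => bandMeasure Ω) j).integral_comp'
      G
  have htermi : ∀ j : Fin (n + 1), Integrable (fun ω : Fin (n + 1) → ℝ => Ψ t (n + 1) ω a c *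
      (starRingEnd ℂ (f u (ω j)) * starRingEnd ℂ (Φ s n (fun i => ω (j.succAbove i)) b d)))
      (Measure.pi fun _ : Fin (n + 1) => bandMeasure Ω) := by
    intro j
    simp only [hpt]
    exact (measurePreserving_piFinSuccAbove (fun _ : Fin (n + 1) => bandMeasure Ω)
      j).integrable_comp_of_integrable hGi
  have hexp : ∀ ω : Fin (n + 1) → ℝ, Ψ t (n + 1) ω a c *
      starRingEnd ℂ (create (f u) (Φ s) (n + 1) ω b d) =
      ((1 / Real.sqrt (n + 1) : ℝ) : ℂ) * ∑ j : Fin (n + 1), Ψ t (n + 1) ω a c *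
        (starRingEnd ℂ (f u (ω j)) * starRingEnd ℂ (Φ s n (fun i => ω (j.succAbove i)) b d)) := by
    intro ω
    rw [create_succ_apply, map_mul, map_sum, Complex.conj_ofReal, mul_left_comm, Finset.mul_sum]
    simp only [map_mul]
  rw [hleft]
  simp only [hexp]
  rw [integral_const_mul, integral_finsetSum _ fun j _ => htermi j]
  simp only [hterm, Finset.sum_const, Finset.card_univ, Fintype.card_fin, nsmul_eq_mul]
  rw [← mul_assoc]
  congr 1
  have hs0 : (0 : ℝ) < Real.sqrt (n + 1) := Real.sqrt_pos.2 (by positivity)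
  have : Real.sqrt (n + 1) = 1 / Real.sqrt (n + 1) * ((n + 1 : ℕ) : ℝ) := by
    rw [eq_comm, one_div, inv_mul_eq_div, div_eq_iff hs0.ne', Real.mul_self_sqrt (by positivity)]
    push_cast
    ring
  exact_mod_cast congrArg (fun x : ℝ => (x : ℂ)) this

/-- The annihilation operator is adjoint to the creation operator on bosonic amplitudes. -/
lemma pairing_annihilate {Ω M : ℝ} {f : ℝ → ℝ → ℂ} (hf : IsBandFamily Ω M f)
    (hΨ : RapidFamily Ψ) (hΦ : RapidFamily Φ) (s t u : ℝ) (hs : IsBosonic (Ψ t))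
    (a c b d : Fin 2) :
    pairing Ω (Φ s) (annihilate (f u) (Ψ t)) a c b d =
      pairing Ω (create (f u) (Φ s)) (Ψ t) a c b d := by
  have hA := (hΨ.at_time t).annihilate (hf.const u)
  have hB := (hΦ.at_time s).create (hf.const u)
  have h1 := hasSum_integral_fockMeasure (hA.measurable_mul_conj hΦ s 0 a c b d)
    (hA.integrable_mul_conj hΦ Ω s 0 a c b d)
  have h2 := hasSum_integral_fockMeasure (hΨ.measurable_mul_conj hB 0 t a c b d)
    (hΨ.integrable_mul_conj hB Ω 0 t a c b d)
  -- A created state has no zero-boson part, so that sector can be dropped and the series compared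
  -- after a shift by one.
  have h3 := (hasSum_nat_add_iff' 1).2 h2
  simp only [Finset.range_one, Finset.sum_singleton, create_zero_apply, map_zero, mul_zero,
    integral_zero, sub_zero] at h3
  simp only [← integral_annihilate_eq_integral_create hf hΨ hΦ s t u hs a c b d] at h3
  exact h1.unique h3

lemma pairing_create {Ω M : ℝ} {f : ℝ → ℝ → ℂ} (hf : IsBandFamily Ω M f)
    (hΨ : RapidFamily Ψ) (hΦ : RapidFamily Φ) (s t u : ℝ) (hs : IsBosonic (Φ s))
    (a c b d : Fin 2) :
    pairing Ω (Φ s) (create (f u) (Ψ t)) a c b d =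
      pairing Ω (annihilate (f u) (Φ s)) (Ψ t) a c b d := by
  rw [← pairing_conj, ← pairing_annihilate hf hΦ hΨ t s u hs, pairing_conj]

end Pairing

/-- The inner product `tr (Ψ (ρ ⊗ 1) Φ†)` of `Φ` and `Ψ` with respect to the initial state `ρ`. -/
def fockForm (Ω : ℝ) (ρ : Matrix (Fin 2) (Fin 2) ℂ) (Φ Ψ : FockMap) : ℂ :=
  ∫ x : BosonConfig, (Ψ x.1 x.2 * ρ * (Φ x.1 x.2).conjTranspose).trace ∂fockMeasure Ω

lemma mul_mul_conjTranspose_apply (A ρ B : Matrix (Fin 2) (Fin 2) ℂ) (a b : Fin 2) :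
    (A * ρ * B.conjTranspose) a b = ∑ c, ∑ d, ρ c d * (A a c * starRingEnd ℂ (B b d)) := by
  simp only [Matrix.mul_apply, Fin.sum_univ_two, Matrix.conjTranspose_apply, RCLike.star_def]
  ring

section Static

variable {Ω : ℝ} {ρ : Matrix (Fin 2) (Fin 2) ℂ} {Ψ Φ X : FockMap}

lemma integrable_mul_mul_conjTranspose (hΨ : RapidFamily fun _ => Ψ) (hΦ : RapidFamily fun _ => Φ)
    (Ω : ℝ) (ρ : Matrix (Fin 2) (Fin 2) ℂ) (a b : Fin 2) :
    Integrable (fun x : BosonConfig => (Ψ x.1 x.2 * ρ * (Φ x.1 x.2).conjTranspose) a b)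
      (fockMeasure Ω) := by
  simp only [mul_mul_conjTranspose_apply]
  exact integrable_finsetSum _ fun c _ => integrable_finsetSum _ fun d _ =>
    (hΨ.integrable_mul_conj hΦ Ω 0 0 a c b d).const_mul _

lemma integrable_trace (hΨ : RapidFamily fun _ => Ψ) (hΦ : RapidFamily fun _ => Φ)
    (Ω : ℝ) (ρ : Matrix (Fin 2) (Fin 2) ℂ) :
    Integrable (fun x : BosonConfig => (Ψ x.1 x.2 * ρ * (Φ x.1 x.2).conjTranspose).trace)
      (fockMeasure Ω) := by
  simp only [Matrix.trace, Matrix.diag_apply]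
  exact integrable_finsetSum _ fun a _ => integrable_mul_mul_conjTranspose hΨ hΦ Ω ρ a a

lemma integral_mul_mul_conjTranspose (hΨ : RapidFamily fun _ => Ψ)
    (hΦ : RapidFamily fun _ => Φ) (a b : Fin 2) :
    ∫ x : BosonConfig, (Ψ x.1 x.2 * ρ * (Φ x.1 x.2).conjTranspose) a b ∂fockMeasure Ω =
      ∑ c, ∑ d, ρ c d * pairing Ω Φ Ψ a c b d := by
  simp only [mul_mul_conjTranspose_apply]
  have hi : ∀ c d, Integrable (fun x : BosonConfig =>
      ρ c d * (Ψ x.1 x.2 a c * starRingEnd ℂ (Φ x.1 x.2 b d))) (fockMeasure Ω) := fun c d =>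
    (hΨ.integrable_mul_conj hΦ Ω 0 0 a c b d).const_mul _
  rw [integral_finsetSum _ fun c _ => integrable_finsetSum _ fun d _ => hi c d]
  refine Finset.sum_congr rfl fun c _ => ?_
  rw [integral_finsetSum _ fun d _ => hi c d]
  exact Finset.sum_congr rfl fun d _ => integral_const_mul _ _

lemma fockForm_eq_sum (hΨ : RapidFamily fun _ => Ψ) (hΦ : RapidFamily fun _ => Φ) :
    fockForm Ω ρ Φ Ψ = ∑ a, ∑ c, ∑ d, ρ c d * pairing Ω Φ Ψ a c a d := by
  simp only [fockForm, Matrix.trace, Matrix.diag_apply]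
  rw [integral_finsetSum _ fun a _ => integrable_mul_mul_conjTranspose hΨ hΦ Ω ρ a a]
  exact Finset.sum_congr rfl fun a _ => integral_mul_mul_conjTranspose hΨ hΦ a a

lemma fockForm_add_right (hΨ : RapidFamily fun _ => Ψ) (hΦ : RapidFamily fun _ => Φ)
    (hX : RapidFamily fun _ => X) :
    fockForm Ω ρ Φ (fun n ω => Ψ n ω + X n ω) = fockForm Ω ρ Φ Ψ + fockForm Ω ρ Φ X := by
  simp only [fockForm, add_mul, Matrix.trace_add]
  exact integral_add (integrable_trace hΨ hΦ Ω ρ) (integrable_trace hX hΦ Ω ρ)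

lemma fockForm_smul_right (c : ℂ) :
    fockForm Ω ρ Φ (fun n ω => c • Ψ n ω) = c * fockForm Ω ρ Φ Ψ := by
  simp only [fockForm, Matrix.smul_mul, Matrix.trace_smul, smul_eq_mul]
  exact integral_const_mul _ _

lemma fockForm_conj (hρ : ρ.IsHermitian) :
    starRingEnd ℂ (fockForm Ω ρ Φ Ψ) = fockForm Ω ρ Ψ Φ := by
  rw [fockForm, ← integral_conj, fockForm]
  congr 1
  funext x
  rw [starRingEnd_apply, ← Matrix.trace_conjTranspose, Matrix.conjTranspose_mul,
    Matrix.conjTranspose_mul, Matrix.conjTranspose_conjTranspose, hρ.eq, mul_assoc]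

lemma fockForm_mul_left {K : Matrix (Fin 2) (Fin 2) ℂ} (hK : K.IsHermitian) :
    fockForm Ω ρ Φ (fun n ω => K * Ψ n ω) = fockForm Ω ρ (fun n ω => K * Φ n ω) Ψ := by
  simp only [fockForm]
  congr 1
  funext x
  rw [Matrix.conjTranspose_mul, hK.eq, Matrix.mul_assoc, Matrix.mul_assoc, Matrix.trace_mul_comm]
  simp only [Matrix.mul_assoc]

lemma fockForm_create {M : ℝ} {f : ℝ → ℝ → ℂ} (hf : IsBandFamily Ω M f) (u : ℝ)
    (hΨ : RapidFamily fun _ => Ψ) (hΦ : RapidFamily fun _ => Φ) (hs : IsBosonic Φ) :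
    fockForm Ω ρ Φ (create (f u) Ψ) = fockForm Ω ρ (annihilate (f u) Φ) Ψ := by
  rw [fockForm_eq_sum (hΨ.create (hf.const u)) hΦ, fockForm_eq_sum hΨ (hΦ.annihilate (hf.const u))]
  simp only [fun a c b d => pairing_create hf hΨ hΦ 0 0 u hs a c b d]

lemma isHermitian_σx : σx.IsHermitian := by
  ext a b
  fin_cases a <;> fin_cases b <;> simp [σx]

lemma isHermitian_σz : σz.IsHermitian := by
  ext a b
  fin_cases a <;> fin_cases b <;> simp [σz]

lemma isHermitian_systemHamiltonian (ω₀ δ : ℝ) : (systemHamiltonian ω₀ δ).IsHermitian := by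
  ext a b
  fin_cases a <;> fin_cases b <;> simp [systemHamiltonian, σx, σz]

/-- The expectation of the Hamiltonian is real. -/
lemma im_fockForm_hamiltonian {M : ℝ} {J : ℝ → ℝ} (hf : IsBandFamily Ω M (coupling J))
    (ω₀ δ t : ℝ) (hΨ : RapidFamily fun _ => Ψ) (hs : IsBosonic Ψ) (hρ : ρ.IsHermitian) :
    (fockForm Ω ρ Ψ (hamiltonian ω₀ δ J t Ψ)).im = 0 := by
  have hA := hΨ.annihilate (hf.const t)
  have hC := hΨ.create (hf.const t)
  have hX := hΨ.mul_left σx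
  have h1 : fockForm Ω ρ Ψ (hamiltonian ω₀ δ J t Ψ) =
      fockForm Ω ρ Ψ (fun n ω => systemHamiltonian ω₀ δ * Ψ n ω) +
      (fockForm Ω ρ (fun n ω => σx * Ψ n ω) (annihilate (coupling J t) Ψ) +
      fockForm Ω ρ (fun n ω => σx * Ψ n ω) (create (coupling J t) Ψ)) := by
    rw [← fockForm_add_right hA hX hC, ← fockForm_mul_left isHermitian_σx]
    exact fockForm_add_right (hΨ.mul_left _) hΨ ((hA.add hC).mul_left _)
  -- The creation and annihilation parts are complex conjugates: the operators are mutually adjoint,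
  -- and the Hermitian `σx` commutes with both.
  have h2 : fockForm Ω ρ (fun n ω => σx * Ψ n ω) (create (coupling J t) Ψ) =
      starRingEnd ℂ (fockForm Ω ρ (fun n ω => σx * Ψ n ω) (annihilate (coupling J t) Ψ)) := by
    rw [fockForm_conj hρ, fockForm_create hf t hΨ hX (hs.mul_left _),
      fockForm_mul_left isHermitian_σx]
    congr 1
    funext n ω
    exact annihilate_mul_left hf hΨ t 0 σx n ω
  have h3 : starRingEnd ℂ (fockForm Ω ρ Ψ (fun n ω => systemHamiltonian ω₀ δ * Ψ n ω)) =
      fockForm Ω ρ Ψ (fun n ω => systemHamiltonian ω₀ δ * Ψ n ω) := by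
    rw [fockForm_conj hρ, fockForm_mul_left (isHermitian_systemHamiltonian ω₀ δ)]
  rw [h1, h2, Complex.add_im, Complex.add_im, Complex.conj_im, Complex.conj_eq_iff_im.1 h3]
  ring

/-- The squared norm with respect to the initial state `ρ`. -/
def fockNormSq (Ω : ℝ) (ρ : Matrix (Fin 2) (Fin 2) ℂ) (Ψ : FockMap) : ℝ := (fockForm Ω ρ Ψ Ψ).re

lemma re_trace_nonneg (hρ : ρ.PosSemidef) (A : Matrix (Fin 2) (Fin 2) ℂ) :
    0 ≤ (A * ρ * A.conjTranspose).trace.re :=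
  (Complex.le_def.1 (hρ.mul_mul_conjTranspose_same A).trace_nonneg).1

lemma fockNormSq_eq_integral (hΨ : RapidFamily fun _ => Ψ) :
    fockNormSq Ω ρ Ψ = ∫ x : BosonConfig,
      (Ψ x.1 x.2 * ρ * (Ψ x.1 x.2).conjTranspose).trace.re ∂fockMeasure Ω :=
  (integral_re (integrable_trace hΨ hΨ Ω ρ)).symm

lemma fockNormSq_nonneg (hρ : ρ.PosSemidef) (hΨ : RapidFamily fun _ => Ψ) :
    0 ≤ fockNormSq Ω ρ Ψ := by
  rw [fockNormSq_eq_integral hΨ]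
  exact integral_nonneg fun x => re_trace_nonneg hρ _

/-- This quadratic in `s` yields Cauchy–Schwarz through its discriminant, and the parallelogram law
from `s = 1` and `s = -1`. -/
lemma fockNormSq_add_smul (hρ : ρ.IsHermitian) (hΨ : RapidFamily fun _ => Ψ)
    (hΦ : RapidFamily fun _ => Φ) (s : ℝ) :
    fockNormSq Ω ρ (fun n ω => Φ n ω + (s : ℂ) • Ψ n ω) =
      fockNormSq Ω ρ Φ + 2 * s * (fockForm Ω ρ Φ Ψ).re + s ^ 2 * fockNormSq Ω ρ Ψ := by
  have hS := hΨ.smul (s : ℂ)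
  have hA := hΦ.add hS
  have h : fockForm Ω ρ (fun n ω => Φ n ω + (s : ℂ) • Ψ n ω)
      (fun n ω => Φ n ω + (s : ℂ) • Ψ n ω) =
      fockForm Ω ρ Φ Φ + s * starRingEnd ℂ (fockForm Ω ρ Φ Ψ) +
        (s * fockForm Ω ρ Φ Ψ + s * (s * fockForm Ω ρ Ψ Ψ)) := by
    rw [fockForm_add_right hΦ hA hS, fockForm_smul_right, ← fockForm_conj hρ (Φ := Φ),
      fockForm_add_right hΦ hΦ hS, ← fockForm_conj hρ (Φ := Ψ), fockForm_add_right hΦ hΨ hS,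
      fockForm_smul_right, fockForm_smul_right, ← fockForm_conj hρ (Φ := Φ) (Ψ := Ψ)]
    simp only [map_add, map_mul, Complex.conj_ofReal, fockForm_conj hρ]
    ring
  rw [fockNormSq, h]
  simp only [Complex.add_re, Complex.re_ofReal_mul, Complex.conj_re, fockNormSq]
  ring

/-- The Cauchy–Schwarz inequality. -/
lemma re_fockForm_sq_le (hρ : ρ.PosSemidef) (hΨ : RapidFamily fun _ => Ψ)
    (hΦ : RapidFamily fun _ => Φ) :
    (fockForm Ω ρ Φ Ψ).re ^ 2 ≤ fockNormSq Ω ρ Φ * fockNormSq Ω ρ Ψ := by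
  have h := discrim_le_zero (a := fockNormSq Ω ρ Ψ) (b := 2 * (fockForm Ω ρ Φ Ψ).re)
    (c := fockNormSq Ω ρ Φ) fun s => by
      have h1 := fockNormSq_nonneg (Ω := Ω) hρ (hΦ.add (hΨ.smul (s : ℂ)))
      rw [fockNormSq_add_smul hρ.1 hΨ hΦ] at h1
      linarith
  rw [discrim] at h
  linarith

lemma abs_re_fockForm_le (hρ : ρ.PosSemidef) (hΨ : RapidFamily fun _ => Ψ)
    (hΦ : RapidFamily fun _ => Φ) :
    |(fockForm Ω ρ Φ Ψ).re| ≤ √(fockNormSq Ω ρ Φ) * √(fockNormSq Ω ρ Ψ) := by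
  rw [← Real.sqrt_mul (fockNormSq_nonneg hρ hΦ)]
  exact Real.abs_le_sqrt (re_fockForm_sq_le hρ hΨ hΦ)

lemma fockNormSq_smul (c : ℂ) :
    fockNormSq Ω ρ (fun n ω => c • Ψ n ω) = ‖c‖ ^ 2 * fockNormSq Ω ρ Ψ := by
  have h : fockForm Ω ρ (fun n ω => c • Ψ n ω) (fun n ω => c • Ψ n ω) =
      ((‖c‖ ^ 2 : ℝ) : ℂ) * fockForm Ω ρ Ψ Ψ := by
    rw [fockForm_smul_right, fockForm, fockForm, ← integral_const_mul, ← integral_const_mul]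
    congr 1
    funext x
    rw [Matrix.conjTranspose_smul, Matrix.mul_smul, Matrix.trace_smul, smul_eq_mul, ← mul_assoc,
      RCLike.star_def, Complex.mul_conj, Complex.normSq_eq_norm_sq]
  rw [fockNormSq, h, Complex.re_ofReal_mul, fockNormSq]

/-- A Hermitian involution is unitary; this serves `σx` in the sources and `σz` as observable. -/
lemma fockNormSq_mul_left {K : Matrix (Fin 2) (Fin 2) ℂ} (hK : K.IsHermitian) (hK2 : K * K = 1) :
    fockNormSq Ω ρ (fun n ω => K * Ψ n ω) = fockNormSq Ω ρ Ψ := by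
  rw [fockNormSq, ← fockForm_mul_left hK]
  simp only [← Matrix.mul_assoc, hK2, one_mul]
  rfl

lemma σx_mul_σx : σx * σx = 1 := by
  ext a b
  fin_cases a <;> fin_cases b <;> simp [σx]

lemma σz_mul_σz : σz * σz = 1 := by
  ext a b
  fin_cases a <;> fin_cases b <;> simp [σz]

end Static

/-! ### Energy estimates -/

section Energy

variable {Ω M : ℝ} {ρ : Matrix (Fin 2) (Fin 2) ℂ} {J : ℝ → ℝ} {Ψ R : ℝ → FockMap}

/-- The expectation of the Hamiltonian is real, so multiplied by `-i` it has no real part; only the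
source `R` changes the norm. -/
lemma hasDerivAt_fockNormSq (hf : IsBandFamily Ω M (coupling J)) (ω₀ δ : ℝ) (hρ : ρ.PosSemidef)
    (hΨ : RapidFamily Ψ) (hR : RapidFamily R) (hs : ∀ t, IsBosonic (Ψ t))
    (hd : ∀ t n ω a b, HasDerivAt (fun t => Ψ t n ω a b)
      (-Complex.I * hamiltonian ω₀ δ J t (Ψ t) n ω a b + R t n ω a b) t) (t : ℝ) :
    HasDerivAt (fun t => fockNormSq Ω ρ (Ψ t)) (2 * (fockForm Ω ρ (Ψ t) (R t)).re) t := by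
  have hH := hΨ.hamiltonian hf ω₀ δ
  have hIH := hH.smul (-Complex.I)
  have hΨ' := hIH.add hR
  have h1 : HasDerivAt (fun t => fockForm Ω ρ (Ψ t) (Ψ t))
      (fockForm Ω ρ (Ψ t) (fun n ω => -Complex.I • hamiltonian ω₀ δ J t (Ψ t) n ω + R t n ω) +
        fockForm Ω ρ (fun n ω => -Complex.I • hamiltonian ω₀ δ J t (Ψ t) n ω + R t n ω) (Ψ t))
      t := by
    simp only [fun t => fockForm_eq_sum (Ω := Ω) (ρ := ρ) (hΨ.at_time t) (hΨ.at_time t),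
      fockForm_eq_sum (Ω := Ω) (ρ := ρ) (hΨ'.at_time t) (hΨ.at_time t),
      fockForm_eq_sum (Ω := Ω) (ρ := ρ) (hΨ.at_time t) (hΨ'.at_time t),
      ← Finset.sum_add_distrib, ← mul_add]
    exact HasDerivAt.fun_sum fun a _ => HasDerivAt.fun_sum fun c _ => HasDerivAt.fun_sum fun d _ =>
      (hasDerivAt_pairing hΨ hΨ hΨ' hΨ' hd hd Ω t a c a d).const_mul _
  have h2 := Complex.reCLM.hasFDerivAt.comp_hasDerivAt t h1
  have h3 : ∀ z : ℂ, (z + starRingEnd ℂ z).re = 2 * z.re := fun z => by simp; ring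
  rw [← fockForm_conj hρ.1 (Φ := Ψ t), Complex.reCLM_apply, h3,
    fockForm_add_right (hIH.at_time t) (hΨ.at_time t) (hR.at_time t), fockForm_smul_right,
    Complex.add_re] at h2
  have h4 : (-Complex.I * fockForm Ω ρ (Ψ t) (hamiltonian ω₀ δ J t (Ψ t))).re = 0 := by
    simp [im_fockForm_hamiltonian hf ω₀ δ t (hΨ.at_time t) (hs t) hρ.1]
  rw [h4, zero_add] at h2
  exact h2

/-- Formally the hypothesis says `(√N)' ≤ g`. Since the square root is not differentiable at `0`,
where `N` starts, the argument runs with `√(N + ε ^ 2)`, and `ε` is arbitrary. -/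
lemma sqrt_le_integral_of_deriv_le {N N' g : ℝ → ℝ} (hN : ∀ t, 0 ≤ N t) (hN0 : N 0 = 0)
    (hd : ∀ t, HasDerivAt N (N' t) t) (hg : Continuous g) (hg0 : ∀ t, 0 < t → 0 ≤ g t)
    (hb : ∀ t, 0 < t → N' t ≤ 2 * (√(N t) * g t)) {t : ℝ} (ht : 0 ≤ t) :
    √(N t) ≤ ∫ s in (0 : ℝ)..t, g s := by
  refine le_of_forall_pos_le_add fun ε hε => ?_
  have hpos : ∀ s, 0 < N s + ε ^ 2 := fun s => by have := hN s; positivity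
  have hder : ∀ s, HasDerivAt (fun s => √(N s + ε ^ 2) - ∫ u in (0 : ℝ)..s, g u)
      (N' s / (2 * √(N s + ε ^ 2)) - g s) s := fun s =>
    (((hd s).add_const _).sqrt (hpos s).ne').sub (hg.integral_hasStrictDerivAt 0 s).hasDerivAt
  have hanti : AntitoneOn (fun s => √(N s + ε ^ 2) - ∫ u in (0 : ℝ)..s, g u) (Set.Ici 0) := by
    refine antitoneOn_of_deriv_nonpos (convex_Ici 0)
      (fun s _ => (hder s).continuousAt.continuousWithinAt)
      (fun s _ => (hder s).differentiableAt.differentiableWithinAt) fun s hs => ?_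
    rw [interior_Ici, Set.mem_Ioi] at hs
    have hs2 : 0 < √(N s + ε ^ 2) := Real.sqrt_pos.2 (hpos s)
    rw [(hder s).deriv, sub_nonpos, div_le_iff₀ (by positivity)]
    have h1 : √(N s) ≤ √(N s + ε ^ 2) := Real.sqrt_le_sqrt (by nlinarith)
    have h2 := mul_le_mul_of_nonneg_right h1 (hg0 s hs)
    linarith [hb s hs]
  have h := hanti Set.self_mem_Ici (Set.mem_Ici.2 ht) ht
  simp only [hN0, zero_add, intervalIntegral.integral_same, sub_zero, Real.sqrt_sq hε.le] at h
  have h1 : √(N t) ≤ √(N t + ε ^ 2) := Real.sqrt_le_sqrt (by nlinarith)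
  linarith

/-- A solution of the inhomogeneous Schrödinger equation that vanishes initially is bounded by the
time integral of the inhomogeneity. -/
lemma sqrt_fockNormSq_le_integral (hf : IsBandFamily Ω M (coupling J)) (ω₀ δ : ℝ)
    (hρ : ρ.PosSemidef) (hΨ : RapidFamily Ψ) (hR : RapidFamily R) (hs : ∀ t, IsBosonic (Ψ t))
    (hd : ∀ t n ω a b, HasDerivAt (fun t => Ψ t n ω a b)
      (-Complex.I * hamiltonian ω₀ δ J t (Ψ t) n ω a b + R t n ω a b) t)
    (h0 : ∀ n ω, Ψ 0 n ω = 0) {g : ℝ → ℝ} (hg : Continuous g)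
    (hRg : ∀ t, 0 < t → √(fockNormSq Ω ρ (R t)) ≤ g t) {t : ℝ} (ht : 0 ≤ t) :
    √(fockNormSq Ω ρ (Ψ t)) ≤ ∫ s in (0 : ℝ)..t, g s := by
  refine sqrt_le_integral_of_deriv_le (fun t => fockNormSq_nonneg hρ (hΨ.at_time t)) ?_
    (hasDerivAt_fockNormSq hf ω₀ δ hρ hΨ hR hs hd) hg
    (fun t ht => (Real.sqrt_nonneg _).trans (hRg t ht)) (fun t ht => ?_) ht
  · simp [fockNormSq, fockForm, h0]
  · have h1 := abs_re_fockForm_le (Ω := Ω) hρ (hR.at_time t) (hΨ.at_time t)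
    have h2 := mul_le_mul_of_nonneg_left (hRg t ht) (Real.sqrt_nonneg (fockNormSq Ω ρ (Ψ t)))
    linarith [le_abs_self (fockForm Ω ρ (Ψ t) (R t)).re]

end Energy

/-! ### Spectral densities on a band -/

/-- Measurable, nonnegative spectral densities bounded by `M ^ 2` and supported in `[0, Ω]`. -/
structure IsBandDensity (Ω M : ℝ) (J : ℝ → ℝ) : Prop where
  measurable : Measurable J
  nonneg : ∀ x, 0 ≤ J x
  sqrt_le : ∀ x, √(J x) ≤ M
  eq_zero : ∀ x, x ∉ Set.Icc 0 Ω → J x = 0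

/-- The part of a spectral density above the Nyquist frequency. -/
def unresolvedSD (J : ℝ → ℝ) (Δt : ℝ) : ℝ → ℝ := (Set.Ioi (Real.pi / Δt)).indicator J

lemma norm_coupling (J : ℝ → ℝ) (t x : ℝ) : ‖coupling J t x‖ = √(J x) := by
  have : Complex.I * x * t = ((x * t : ℝ) : ℂ) * Complex.I := by push_cast; ring
  rw [coupling, norm_mul, Complex.norm_real, Real.norm_of_nonneg (Real.sqrt_nonneg _), this,
    Complex.norm_exp_ofReal_mul_I, mul_one]

section Density

variable {Ω M : ℝ} {J : ℝ → ℝ}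

lemma IsBandDensity.isBandFamily (hJ : IsBandDensity Ω M J) : IsBandFamily Ω M (coupling J) := by
  refine ⟨fun t => ?_, fun x => ?_, fun t x => ?_, fun t x hx => ?_⟩
  · exact (Complex.measurable_ofReal.comp hJ.measurable.sqrt).mul (by fun_prop)
  · unfold coupling
    fun_prop
  · rw [norm_coupling]
    exact hJ.sqrt_le x
  · simp [coupling, hJ.eq_zero x hx]

lemma IsBandDensity.indicator (hJ : IsBandDensity Ω M J) {s : Set ℝ} (hs : MeasurableSet s) :
    IsBandDensity Ω M (s.indicator J) := by
  refine ⟨hJ.measurable.indicator hs, fun x => Set.indicator_nonneg (fun _ _ => hJ.nonneg _) x,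
    fun x => ?_, fun x hx => ?_⟩
  · exact (Real.sqrt_le_sqrt (Set.indicator_le_self' (fun _ _ => hJ.nonneg _) x)).trans
      (hJ.sqrt_le x)
  · by_cases hs : x ∈ s
    · rw [Set.indicator_of_mem hs, hJ.eq_zero x hx]
    · exact Set.indicator_of_notMem hs J

lemma IsBandDensity.sampled (hJ : IsBandDensity Ω M J) (Δt : ℝ) :
    IsBandDensity Ω M (sampledSD J Δt) := hJ.indicator measurableSet_Iic

lemma IsBandDensity.unresolved (hJ : IsBandDensity Ω M J) (Δt : ℝ) :
    IsBandDensity Ω M (unresolvedSD J Δt) := hJ.indicator measurableSet_Ioi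

lemma IsBandDensity.integrable (hJ : IsBandDensity Ω M J) : Integrable J := by
  have h : IntegrableOn J (Set.Icc 0 Ω) := by
    refine Measure.integrableOn_of_bounded (M := M ^ 2) (by simp)
      hJ.measurable.aestronglyMeasurable (Filter.Eventually.of_forall fun x => ?_)
    rw [Real.norm_of_nonneg (hJ.nonneg x)]
    exact (Real.sqrt_le_left ((Real.sqrt_nonneg _).trans (hJ.sqrt_le x))).1 (hJ.sqrt_le x)
  exact (integrableOn_iff_integrable_of_support_subset fun x hx => by
    by_contra hn; exact hx (hJ.eq_zero x hn)).1 h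

lemma norm_exp_neg_I_mul (x τ : ℝ) : ‖Complex.exp (-Complex.I * x * τ)‖ = 1 := by
  have : -Complex.I * x * τ = ((-(x * τ) : ℝ) : ℂ) * Complex.I := by push_cast; ring
  rw [this, Complex.norm_exp_ofReal_mul_I]

lemma IsBandDensity.integrable_mul_exp (hJ : IsBandDensity Ω M J) (τ : ℝ) :
    Integrable fun ω : ℝ => (J ω : ℂ) * Complex.exp (-Complex.I * ω * τ) := by
  refine hJ.integrable.mono' ?_ (Filter.Eventually.of_forall fun x => ?_)
  · exact ((Complex.measurable_ofReal.comp hJ.measurable).mul (by fun_prop)).aestronglyMeasurable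
  · rw [norm_mul, Complex.norm_real, Real.norm_of_nonneg (hJ.nonneg x), norm_exp_neg_I_mul, mul_one]

lemma IsBandDensity.continuous_bathCorrelation (hJ : IsBandDensity Ω M J) :
    Continuous (bathCorrelation J) := by
  refine continuous_of_dominated (bound := J) (fun τ => (hJ.integrable_mul_exp τ).1)
    (fun τ => Filter.Eventually.of_forall fun x => ?_) hJ.integrable
    (Filter.Eventually.of_forall fun x => by fun_prop)
  rw [norm_mul, Complex.norm_real, Real.norm_of_nonneg (hJ.nonneg x), norm_exp_neg_I_mul, mul_one]

lemma IsBandDensity.continuous_correlationError (hJ : IsBandDensity Ω M J) (Δt : ℝ) :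
    Continuous (correlationError J Δt) :=
  hJ.continuous_bathCorrelation.sub (hJ.sampled Δt).continuous_bathCorrelation

lemma sampledSD_add_unresolvedSD (J : ℝ → ℝ) (Δt x : ℝ) :
    sampledSD J Δt x + unresolvedSD J Δt x = J x := by
  rw [sampledSD, unresolvedSD, ← Set.compl_Iic]
  exact congrFun (Set.indicator_self_add_compl _ J) x

lemma IsBandDensity.correlationError_eq (hJ : IsBandDensity Ω M J) (Δt τ : ℝ) :
    correlationError J Δt τ = bathCorrelation (unresolvedSD J Δt) τ := by
  rw [correlationError, bathCorrelation, bathCorrelation,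
    ← integral_sub (hJ.integrable_mul_exp τ) ((hJ.sampled Δt).integrable_mul_exp τ),
    bathCorrelation]
  congr 1
  funext x
  rw [← sampledSD_add_unresolvedSD J Δt x]
  push_cast
  ring

/-- Above the cut both couplings carry `√J`, whose product is `J`, and the phases combine to depend
on `s - t`; below it the first coupling vanishes. This is how `ΔC` enters the dynamics, as a
commutator. -/
lemma IsBandDensity.bandInner_unresolved (hJ : IsBandDensity Ω M J) (Δt s t : ℝ) :
    bandInner Ω (coupling (unresolvedSD J Δt) s) (coupling J t) =
      correlationError J Δt (s - t) := by
  have h : ∀ x, starRingEnd ℂ (coupling (unresolvedSD J Δt) s x) * coupling J t x =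
      (unresolvedSD J Δt x : ℂ) * Complex.exp (-Complex.I * x * ((s - t : ℝ) : ℂ)) := by
    intro x
    by_cases hx : x ∈ Set.Ioi (Real.pi / Δt)
    · have e1 : starRingEnd ℂ (Complex.exp (Complex.I * x * s)) =
          Complex.exp (-Complex.I * x * s) := by
        rw [← Complex.exp_conj]; simp
      have e2 : (√(J x) : ℂ) * √(J x) = J x := by
        rw [← Complex.ofReal_mul, Real.mul_self_sqrt (hJ.nonneg x)]
      simp only [coupling, unresolvedSD, Set.indicator_of_mem hx, map_mul, Complex.conj_ofReal, e1]
      calc _ = ((√(J x) : ℂ) * √(J x)) *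
            (Complex.exp (-Complex.I * x * s) * Complex.exp (Complex.I * x * t)) := by ring
        _ = _ := by
            rw [e2, ← Complex.exp_add]
            congr 2
            push_cast
            ring
    · simp [coupling, unresolvedSD, Set.indicator_of_notMem hx]
  rw [hJ.correlationError_eq, bandInner, bathCorrelation]
  simp only [h]
  refine setIntegral_eq_integral_of_forall_compl_eq_zero fun x hx => ?_
  rw [(hJ.unresolved Δt).eq_zero x hx]
  simp

end Density

/-! ### Conservation of the norm -/

/-- Only the zero-boson sector contributes, a single point of mass one. -/
lemma fockNormSq_vacuum (Ω : ℝ) (ρ : Matrix (Fin 2) (Fin 2) ℂ) :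
    fockNormSq Ω ρ vacuum = ρ.trace.re := by
  have h := hasSum_integral_fockMeasure (Ω := Ω)
    (F := fun x => (vacuum x.1 x.2 * ρ * (vacuum x.1 x.2).conjTranspose).trace)
    (measurable_bosonConfig fun n => measurable_const' fun _ _ => rfl)
    (integrable_trace rapidFamily_vacuum rapidFamily_vacuum Ω ρ)
  have h2 := h.unique (hasSum_single 0 fun n hn => by simp [vacuum, hn])
  rw [fockNormSq, fockForm, h2]
  simp [vacuum, measureReal_def]

section Conservation

variable {Ω M : ℝ} {J : ℝ → ℝ} {ρ : Matrix (Fin 2) (Fin 2) ℂ}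

/-- Without a source the norm has zero derivative, and initially it is `tr ρ = 1`. -/
lemma fockNormSq_evolved (hf : IsBandFamily Ω M (coupling J)) (ω₀ δ : ℝ) (hρ : IsDensityMatrix ρ)
    (t : ℝ) : fockNormSq Ω ρ (evolved ω₀ δ J t) = 1 := by
  have hψ := rapidFamily_evolved hf ω₀ δ
  have hR : RapidFamily fun (_ : ℝ) n (_ : Fin n → ℝ) => (0 : Matrix (Fin 2) (Fin 2) ℂ) := by
    simpa using hψ.smul 0
  have hd : ∀ t, HasDerivAt (fun t => fockNormSq Ω ρ (evolved ω₀ δ J t)) 0 t := by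
    intro t
    have h := hasDerivAt_fockNormSq hf ω₀ δ hρ.1 hψ hR (isBosonic_evolved ω₀ δ J)
      (fun t n ω a b => by simpa using hasDerivAt_evolved hf ω₀ δ t n ω a b) t
    simpa [fockForm] using h
  have h0 : evolved ω₀ δ J 0 = vacuum := by
    funext n ω
    exact evolved_zero hf ω₀ δ n ω
  rw [is_const_of_deriv_eq_zero (fun t => (hd t).differentiableAt) (fun t => (hd t).deriv) t 0, h0,
    fockNormSq_vacuum, hρ.2, Complex.one_re]

end Conservation

/-! ### The amplitude of an unresolved boson -/

section Annihilated

variable {Ω M : ℝ} {h : ℝ → ℝ → ℂ} {Ψ Ψ' : ℝ → FockMap}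

lemma hasDerivAt_annihilate (hh : IsBandFamily Ω M h) (hΨ : RapidFamily Ψ) (hΨ' : RapidFamily Ψ')
    (hd : ∀ t n ω a b, HasDerivAt (fun t => Ψ t n ω a b) (Ψ' t n ω a b) t)
    (s t : ℝ) (n : ℕ) (ω : Fin n → ℝ) (a b : Fin 2) :
    HasDerivAt (fun t => annihilate (h s) (Ψ t) n ω a b) (annihilate (h s) (Ψ' t) n ω a b) t := by
  simp only [annihilate_apply hh]
  refine HasDerivAt.const_mul _ ?_
  obtain ⟨C, hC0, hC⟩ := hΨ'.norm_le (|t| + 1)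
  refine (hasDerivAt_integral_of_dominated_loc_of_deriv_le (bound := fun _ => M * C)
    (Metric.ball_mem_nhds t one_pos)
    (Filter.Eventually.of_forall fun u => (hΨ.integrable_mul_cons hh s u n ω a b).1)
    (hΨ.integrable_mul_cons hh s t n ω a b) (hΨ'.integrable_mul_cons hh s t n ω a b).1
    (Filter.Eventually.of_forall fun x u hu => ?_) (integrable_const _)
    (Filter.Eventually.of_forall fun x u _ => (hd u _ _ a b).const_mul _)).2
  have hu' : |u| ≤ |t| + 1 := by
    rw [Metric.mem_ball, Real.dist_eq] at hu
    linarith [abs_sub_abs_le_abs_sub u t]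
  rw [norm_mul, RCLike.norm_conj]
  exact mul_le_mul (hh.norm_le s x) (hC u hu' _ _ _ _) (norm_nonneg _) hh.nonneg

lemma annihilate_smul (f : ℝ → ℂ) (Φ : FockMap) (c : ℂ) (n : ℕ) (ω : Fin n → ℝ) :
    annihilate f (fun n ω => c • Φ n ω) n ω = c • annihilate f Φ n ω := by
  ext a b
  simp only [annihilate, Matrix.smul_apply, Matrix.of_apply, smul_eq_mul,
    mul_left_comm (starRingEnd ℂ _) c, integral_const_mul]
  ring

variable {J : ℝ → ℝ} {ρ : Matrix (Fin 2) (Fin 2) ℂ}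

/-- For frozen `τ`, commuting the annihilation operator past the Hamiltonian shows that the
annihilated state solves the same equation with source `-i ΔC(τ - t) σx ψ(t)`. The source has norm
`|ΔC(τ - t)|`, and the initial value is zero because the vacuum holds no boson to annihilate. -/
lemma sqrt_fockNormSq_annihilate_le (hJ : IsBandDensity Ω M J) (ω₀ δ Δt : ℝ)
    (hρ : IsDensityMatrix ρ) (τ : ℝ) {t : ℝ} (ht : 0 ≤ t) :
    √(fockNormSq Ω ρ (annihilate (coupling (unresolvedSD J Δt) τ) (evolved ω₀ δ J t))) ≤
      ∫ s in (0 : ℝ)..t, ‖correlationError J Δt (τ - s)‖ := by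
  have hf := hJ.isBandFamily
  have hh := (hJ.unresolved Δt).isBandFamily
  have hψ := rapidFamily_evolved hf ω₀ δ
  have hc : Continuous fun t => correlationError J Δt (τ - t) :=
    (hJ.continuous_correlationError Δt).comp (continuous_const.sub continuous_id)
  have hR := (hψ.mul_left σx).smul_of_bounded
    (c := fun t => -Complex.I * correlationError J Δt (τ - t)) (continuous_const.mul hc)
  refine sqrt_fockNormSq_le_integral hf ω₀ δ hρ.1
    (Ψ := fun t => annihilate (coupling (unresolvedSD J Δt) τ) (evolved ω₀ δ J t))
    (hψ.annihilate (hh.const τ)) hR (fun t => (isBosonic_evolved ω₀ δ J t).annihilate _)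
    (fun t n ω a b => ?_) (fun n ω => ?_) hc.norm (fun t _ => ?_) ht
  · have h1 := hasDerivAt_annihilate hh hψ ((hψ.hamiltonian hf ω₀ δ).smul (-Complex.I))
      (fun t n ω a b => hasDerivAt_evolved hf ω₀ δ t n ω a b) τ t n ω a b
    convert h1 using 1
    rw [annihilate_smul, annihilate_hamiltonian hh hf hψ τ t (isBosonic_evolved ω₀ δ J t),
      hJ.bandInner_unresolved]
    simp only [Matrix.smul_apply, Matrix.add_apply, smul_eq_mul]
    ring
  · ext a b
    rw [annihilate_apply hh]
    simp [evolved_zero hf, vacuum]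
  · rw [fockNormSq_smul, fockNormSq_mul_left isHermitian_σx σx_mul_σx,
      fockNormSq_evolved hf ω₀ δ hρ, mul_one, Real.sqrt_sq (norm_nonneg _)]
    simp

end Annihilated

/-! ### Projection onto the resolved bosons -/

open scoped Classical in
/-- The projection onto the configurations without bosons of frequency above `Λ`. -/
def lowPass (Λ : ℝ) (Ψ : FockMap) : FockMap := fun n ω => if ∀ i, ω i ≤ Λ then Ψ n ω else 0

section LowPass

variable {Λ : ℝ}

lemma lowPass_of_le {n : ℕ} {ω : Fin n → ℝ} (h : ∀ i, ω i ≤ Λ) (Ψ : FockMap) :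
    lowPass Λ Ψ n ω = Ψ n ω := if_pos h

lemma lowPass_of_not {n : ℕ} {ω : Fin n → ℝ} (h : ¬ ∀ i, ω i ≤ Λ) (Ψ : FockMap) :
    lowPass Λ Ψ n ω = 0 := if_neg h

lemma RapidFamily.lowPass {Ψ : ℝ → FockMap} (h : RapidFamily Ψ) (Λ : ℝ) :
    RapidFamily fun t => lowPass Λ (Ψ t) := by
  classical
  refine ⟨fun t n a b => ?_, fun n ω a b => ?_, fun T r hr => ?_⟩
  · have e : (fun ω => SpinBoson.lowPass Λ (Ψ t) n ω a b) =
        {ω : Fin n → ℝ | ∀ i, ω i ≤ Λ}.indicator fun ω => Ψ t n ω a b := by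
      funext ω
      by_cases hω : ∀ i, ω i ≤ Λ
      · rw [lowPass_of_le hω, Set.indicator_of_mem (by exact hω)]
      · rw [lowPass_of_not hω, Set.indicator_of_notMem (by exact hω)]
        rfl
    rw [e]
    refine (h.measurable t n a b).indicator ?_
    rw [Set.ofPred_forall]
    exact MeasurableSet.iInter fun i => measurableSet_le (measurable_pi_apply i) measurable_const
  · by_cases hω : ∀ i, ω i ≤ Λ
    · simpa only [lowPass_of_le hω] using h.continuous n ω a b
    · simpa only [lowPass_of_not hω] using continuous_const
  · obtain ⟨C, hC0, hC⟩ := h.bound T r hr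
    refine ⟨C, hC0, fun t ht n ω a b => ?_⟩
    by_cases hω : ∀ i, ω i ≤ Λ
    · rw [lowPass_of_le hω]
      exact hC t ht n ω a b
    · rw [lowPass_of_not hω]
      simpa using hC0

lemma IsBosonic.lowPass {Ψ : FockMap} (h : IsBosonic Ψ) (Λ : ℝ) : IsBosonic (lowPass Λ Ψ) := by
  intro n π ω
  have e : (∀ i, (ω ∘ π) i ≤ Λ) ↔ ∀ i, ω i ≤ Λ :=
    ⟨fun h i => by simpa using h (π.symm i), fun h i => h (π i)⟩
  by_cases hω : ∀ i, ω i ≤ Λ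
  · rw [lowPass_of_le hω, lowPass_of_le (e.2 hω), h]
  · rw [lowPass_of_not hω, lowPass_of_not (mt e.1 hω)]

lemma fockNormSq_lowPass_le {Ω : ℝ} {ρ : Matrix (Fin 2) (Fin 2) ℂ} (hρ : ρ.PosSemidef)
    {Ψ : FockMap} (hΨ : RapidFamily fun _ => Ψ) (Λ : ℝ) :
    fockNormSq Ω ρ (lowPass Λ Ψ) ≤ fockNormSq Ω ρ Ψ := by
  rw [fockNormSq_eq_integral hΨ, fockNormSq_eq_integral (hΨ.lowPass Λ)]
  refine integral_mono (integrable_trace (hΨ.lowPass Λ) (hΨ.lowPass Λ) Ω ρ).re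
    (integrable_trace hΨ hΨ Ω ρ).re fun x => ?_
  by_cases hω : ∀ i, x.2 i ≤ Λ
  · simp only [lowPass_of_le hω]
    exact le_rfl
  · simp only [lowPass_of_not hω]
    simpa using re_trace_nonneg hρ _

/-- `K` acts on the spin alone, and at each boson configuration either the projected part or its
complement is zero, so no cross terms arise. -/
lemma fockForm_mul_left_split {Ω : ℝ} {ρ : Matrix (Fin 2) (Fin 2) ℂ} {Ψ : FockMap}
    (hΨ : RapidFamily fun _ => Ψ) (Λ : ℝ) (K : Matrix (Fin 2) (Fin 2) ℂ) :
    fockForm Ω ρ Ψ (fun n ω => K * Ψ n ω) =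
      fockForm Ω ρ (lowPass Λ Ψ) (fun n ω => K * lowPass Λ Ψ n ω) +
        fockForm Ω ρ (fun n ω => Ψ n ω - lowPass Λ Ψ n ω)
          (fun n ω => K * (Ψ n ω - lowPass Λ Ψ n ω)) := by
  have hP := hΨ.lowPass Λ
  have hQ := hΨ.sub hP
  rw [fockForm, fockForm, fockForm, ← integral_add (integrable_trace (hP.mul_left K) hP Ω ρ)
    (integrable_trace (hQ.mul_left K) hQ Ω ρ)]
  congr 1
  funext x
  by_cases hω : ∀ i, x.2 i ≤ Λ
  · simp [lowPass_of_le hω]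
  · simp [lowPass_of_not hω]

lemma coupling_sampledSD_of_le {Δt x : ℝ} (hx : x ≤ Real.pi / Δt) (J : ℝ → ℝ) (t : ℝ) :
    coupling (sampledSD J Δt) t x = coupling J t x := by
  simp [coupling, sampledSD, hx]

lemma coupling_sampledSD_of_lt {Δt x : ℝ} (hx : Real.pi / Δt < x) (J : ℝ → ℝ) (t : ℝ) :
    coupling (sampledSD J Δt) t x = 0 := by
  simp [coupling, sampledSD, hx.not_ge]

lemma coupling_unresolvedSD_of_le {Δt x : ℝ} (hx : x ≤ Real.pi / Δt) (J : ℝ → ℝ) (t : ℝ) :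
    coupling (unresolvedSD J Δt) t x = 0 := by
  simp [coupling, unresolvedSD, hx.not_gt]

lemma coupling_unresolvedSD_of_lt {Δt x : ℝ} (hx : Real.pi / Δt < x) (J : ℝ → ℝ) (t : ℝ) :
    coupling (unresolvedSD J Δt) t x = coupling J t x := by
  simp [coupling, unresolvedSD, hx]

/-- An unresolved boson after creation was either just created, which the sampled coupling excludes,
or already present, which the projection excludes. -/
lemma lowPass_create (J : ℝ → ℝ) (Δt t : ℝ) (Ψ : FockMap) (n : ℕ) (ω : Fin n → ℝ) :
    lowPass (Real.pi / Δt) (create (coupling J t) Ψ) n ω =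
      create (coupling (sampledSD J Δt) t) (lowPass (Real.pi / Δt) Ψ) n ω := by
  cases n with
  | zero => rw [lowPass_of_le fun i => i.elim0]; rfl
  | succ n =>
    ext a b
    by_cases hω : ∀ i, ω i ≤ Real.pi / Δt
    · rw [lowPass_of_le hω, create_succ_apply, create_succ_apply]
      congr 1
      refine Finset.sum_congr rfl fun j _ => ?_
      rw [coupling_sampledSD_of_le (hω j), lowPass_of_le fun i => hω _]
    · rw [lowPass_of_not hω, create_succ_apply, Finset.sum_eq_zero, mul_zero, Matrix.zero_apply]
      intro j _
      rcases le_or_gt (ω j) (Real.pi / Δt) with hj | hj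
      · rw [lowPass_of_not, Matrix.zero_apply, mul_zero]
        refine fun h => hω fun i => ?_
        rcases eq_or_ne i j with rfl | hij
        · exact hj
        · obtain ⟨l, rfl⟩ := Fin.exists_succAbove_eq hij
          exact h l
      · rw [coupling_sampledSD_of_lt hj, zero_mul]

/-- The integral over the removed frequency splits at `π / Δt`. The upper part survives the
projection, since it turns a state with one unresolved boson into a resolved one. -/
lemma lowPass_annihilate {Ω M : ℝ} {J : ℝ → ℝ} (hJ : IsBandDensity Ω M J) (Δt t : ℝ) {Ψ : FockMap}
    (hΨ : RapidFamily fun _ => Ψ) (n : ℕ) (ω : Fin n → ℝ) :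
    lowPass (Real.pi / Δt) (annihilate (coupling J t) Ψ) n ω =
      annihilate (coupling (sampledSD J Δt) t) (lowPass (Real.pi / Δt) Ψ) n ω +
        lowPass (Real.pi / Δt) (annihilate (coupling (unresolvedSD J Δt) t) Ψ) n ω := by
  have hf := hJ.isBandFamily
  have hg := (hJ.sampled Δt).isBandFamily
  have hh := (hJ.unresolved Δt).isBandFamily
  have hcons : ∀ x, (∀ i, (Fin.cons x ω : Fin (n + 1) → ℝ) i ≤ Real.pi / Δt) ↔
      x ≤ Real.pi / Δt ∧ ∀ i, ω i ≤ Real.pi / Δt := by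
    intro x
    rw [Fin.forall_fin_succ]
    simp
  ext a b
  rw [Matrix.add_apply]
  by_cases hω : ∀ i, ω i ≤ Real.pi / Δt
  · rw [lowPass_of_le hω, lowPass_of_le hω, annihilate_apply hf, annihilate_apply hg,
      annihilate_apply hh, ← mul_add, ← integral_add
      ((hΨ.lowPass _).integrable_mul_cons hg t 0 n ω a b) (hΨ.integrable_mul_cons hh t 0 n ω a b)]
    congr 2
    funext x
    rcases le_or_gt x (Real.pi / Δt) with hx | hx
    · rw [lowPass_of_le ((hcons x).2 ⟨hx, hω⟩), coupling_sampledSD_of_le hx,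
        coupling_unresolvedSD_of_le hx, map_zero, zero_mul, add_zero]
    · rw [coupling_sampledSD_of_lt hx, coupling_unresolvedSD_of_lt hx, map_zero, zero_mul, zero_add]
  · rw [lowPass_of_not hω, lowPass_of_not hω, annihilate_apply hg]
    simp only [fun x => lowPass_of_not (mt (fun h => ((hcons x).1 h).2) hω) Ψ]
    simp

lemma lowPass_hamiltonian {Ω M : ℝ} {J : ℝ → ℝ} (hJ : IsBandDensity Ω M J) (ω₀ δ Δt t : ℝ)
    {Ψ : FockMap} (hΨ : RapidFamily fun _ => Ψ) (n : ℕ) (ω : Fin n → ℝ) :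
    lowPass (Real.pi / Δt) (hamiltonian ω₀ δ J t Ψ) n ω =
      hamiltonian ω₀ δ (sampledSD J Δt) t (lowPass (Real.pi / Δt) Ψ) n ω +
        σx * lowPass (Real.pi / Δt) (annihilate (coupling (unresolvedSD J Δt) t) Ψ) n ω := by
  have h1 := lowPass_create J Δt t Ψ n ω
  have h2 := lowPass_annihilate hJ Δt t hΨ n ω
  rw [hamiltonian, ← h1, add_assoc, ← mul_add, add_right_comm, ← h2]
  by_cases hω : ∀ i, ω i ≤ Real.pi / Δt
  · simp only [lowPass_of_le hω, hamiltonian]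
  · simp only [lowPass_of_not hω, mul_zero, add_zero]

end LowPass

/-! ### The distance to the resolved evolution -/

section Distance

variable {Ω M : ℝ} {J : ℝ → ℝ} {ρ : Matrix (Fin 2) (Fin 2) ℂ}

lemma hamiltonian_sub (hf : IsBandFamily Ω M (coupling J)) (ω₀ δ t : ℝ) {Ψ Φ : FockMap}
    (hΨ : RapidFamily fun _ => Ψ) (hΦ : RapidFamily fun _ => Φ) (n : ℕ) (ω : Fin n → ℝ) :
    hamiltonian ω₀ δ J t (fun n ω => Ψ n ω - Φ n ω) n ω =
      hamiltonian ω₀ δ J t Ψ n ω - hamiltonian ω₀ δ J t Φ n ω := by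
  have hD := hΨ.sub hΦ
  have h1 := annihilate_add hf hD hΦ t t n ω
  have h2 := create_add (coupling J t) (fun n ω => Ψ n ω - Φ n ω) Φ n ω
  simp only [sub_add_cancel] at h1 h2
  rw [hamiltonian, hamiltonian, hamiltonian, h1, h2]
  noncomm_ring

lemma hasDerivAt_lowPass_evolved (hf : IsBandFamily Ω M (coupling J)) (ω₀ δ Λ t : ℝ) (n : ℕ)
    (ω : Fin n → ℝ) (a b : Fin 2) :
    HasDerivAt (fun t => lowPass Λ (evolved ω₀ δ J t) n ω a b)
      (-Complex.I * lowPass Λ (hamiltonian ω₀ δ J t (evolved ω₀ δ J t)) n ω a b) t := by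
  by_cases hω : ∀ i, ω i ≤ Λ
  · simp only [lowPass_of_le hω]
    exact hasDerivAt_evolved hf ω₀ δ t n ω a b
  · simp only [lowPass_of_not hω, Matrix.zero_apply, mul_zero]
    exact hasDerivAt_const t _

/-- Reflecting `t''` to `t' - t''` removes `t'` from the integrand and leaves a primitive. -/
lemma IsBandDensity.continuous_integral_correlationError (hJ : IsBandDensity Ω M J) (Δt : ℝ) :
    Continuous fun t' : ℝ => ∫ t'' in (0 : ℝ)..t', ‖correlationError J Δt (t' - t'')‖ := by
  have e : ∀ t' : ℝ, ∫ t'' in (0 : ℝ)..t', ‖correlationError J Δt (t' - t'')‖ =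
      ∫ u in (0 : ℝ)..t', ‖correlationError J Δt u‖ := fun t' => by
    rw [intervalIntegral.integral_comp_sub_left (fun u => ‖correlationError J Δt u‖) t']
    simp
  simp only [e]
  exact intervalIntegral.continuous_primitive
    (fun a b => (hJ.continuous_correlationError Δt).norm.intervalIntegrable a b) 0

/-- The distance between the resolved part of the exact state and the state that evolved with the
resolved part of the bath. -/
lemma sqrt_fockNormSq_lowPass_sub_le (hJ : IsBandDensity Ω M J) (ω₀ δ Δt : ℝ)
    (hρ : IsDensityMatrix ρ) {t : ℝ} (ht : 0 ≤ t) :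
    √(fockNormSq Ω ρ (fun n ω => lowPass (Real.pi / Δt) (evolved ω₀ δ J t) n ω -
        evolved ω₀ δ (sampledSD J Δt) t n ω)) ≤
      ∫ t' in (0 : ℝ)..t, ∫ t'' in (0 : ℝ)..t', ‖correlationError J Δt (t' - t'')‖ := by
  set Λ := Real.pi / Δt with hΛ
  have hf := hJ.isBandFamily
  have hg := (hJ.sampled Δt).isBandFamily
  have hh := (hJ.unresolved Δt).isBandFamily
  have hψ := rapidFamily_evolved hf ω₀ δ
  have hφ := rapidFamily_evolved hg ω₀ δ
  have hcont := hJ.continuous_integral_correlationError Δt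
  refine sqrt_fockNormSq_le_integral hg ω₀ δ hρ.1
    (Ψ := fun t n ω => lowPass Λ (evolved ω₀ δ J t) n ω - evolved ω₀ δ (sampledSD J Δt) t n ω)
    ((hψ.lowPass Λ).sub hφ) ((((hψ.annihilate hh).lowPass Λ).mul_left σx).smul (-Complex.I))
    (fun t => ((isBosonic_evolved ω₀ δ J t).lowPass Λ).sub (isBosonic_evolved ω₀ δ _ t))
    (fun t n ω a b => ?_) (fun n ω => ?_) hcont (fun t ht => ?_) ht
  · refine ((hasDerivAt_lowPass_evolved hf ω₀ δ Λ t n ω a b).fun_sub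
      (hasDerivAt_evolved hg ω₀ δ t n ω a b)).congr_deriv ?_
    rw [hamiltonian_sub hg ω₀ δ t ((hψ.lowPass Λ).at_time t) (hφ.at_time t),
      lowPass_hamiltonian hJ ω₀ δ Δt t (hψ.at_time t)]
    simp only [Matrix.smul_apply, Matrix.add_apply, Matrix.sub_apply, smul_eq_mul]
    ring
  · by_cases hω : ∀ i, ω i ≤ Λ
    · rw [lowPass_of_le hω, evolved_zero hf, evolved_zero hg, sub_self]
    · have hn : n ≠ 0 := by rintro rfl; exact hω fun i => i.elim0
      rw [lowPass_of_not hω, evolved_zero hg, vacuum, if_neg hn, sub_zero]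
  · rw [fockNormSq_smul, fockNormSq_mul_left isHermitian_σx σx_mul_σx, norm_neg, Complex.norm_I,
      one_pow, one_mul]
    refine (Real.sqrt_le_sqrt (fockNormSq_lowPass_le hρ.1
      ((hψ.annihilate hh).at_time t) Λ)).trans ?_
    -- The frozen parameter is set to the current time, which produces `ΔC(t' - t'')`.
    exact sqrt_fockNormSq_annihilate_le hJ ω₀ δ Δt hρ t ht.le

/-- The two cross terms are complex conjugates of each other, and they enter with opposite signs. -/
lemma re_fockForm_sub_add {Φ Ψ : FockMap} (hρ : ρ.IsHermitian) (hΨ : RapidFamily fun _ => Ψ)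
    (hΦ : RapidFamily fun _ => Φ) {K : Matrix (Fin 2) (Fin 2) ℂ} (hK : K.IsHermitian) :
    (fockForm Ω ρ (fun n ω => Ψ n ω - Φ n ω) (fun n ω => K * (Ψ n ω + Φ n ω))).re =
      (fockForm Ω ρ Ψ (fun n ω => K * Ψ n ω)).re - (fockForm Ω ρ Φ (fun n ω => K * Φ n ω)).re := by
  have hD := hΨ.sub hΦ
  have h : ∀ X : FockMap, (RapidFamily fun _ => X) →
      fockForm Ω ρ (fun n ω => Ψ n ω - Φ n ω) X = fockForm Ω ρ Ψ X - fockForm Ω ρ Φ X := by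
    intro X hX
    have h1 := fockForm_add_right (Ω := Ω) (ρ := ρ) hD hX hΦ
    simp only [sub_add_cancel] at h1
    rw [← fockForm_conj hρ, ← fockForm_conj hρ (Ψ := Ψ), ← fockForm_conj hρ (Ψ := Φ), ← map_sub, h1,
      add_sub_cancel_right]
  have hKΨ := hΨ.mul_left K
  have hKΦ := hΦ.mul_left K
  simp only [mul_add]
  rw [fockForm_add_right hKΨ hD hKΦ, h _ hKΨ, h _ hKΦ]
  have h2 : fockForm Ω ρ Φ (fun n ω => K * Ψ n ω) =
      starRingEnd ℂ (fockForm Ω ρ Ψ (fun n ω => K * Φ n ω)) := by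
    rw [fockForm_conj hρ, fockForm_mul_left hK]
  rw [h2]
  simp only [Complex.add_re, Complex.sub_re, Complex.conj_re]
  ring

/-- The difference of the expectation values is at most four times the distance. -/
lemma abs_re_fockForm_sub_le {ψ φ : FockMap} (hρ : ρ.PosSemidef) (hψ : RapidFamily fun _ => ψ)
    (hφ : RapidFamily fun _ => φ) (hψ1 : fockNormSq Ω ρ ψ = 1) (hφ1 : fockNormSq Ω ρ φ = 1)
    (Λ : ℝ) {K : Matrix (Fin 2) (Fin 2) ℂ} (hK : K.IsHermitian) (hK2 : K * K = 1) :
    |(fockForm Ω ρ ψ (fun n ω => K * ψ n ω)).re - (fockForm Ω ρ φ (fun n ω => K * φ n ω)).re| ≤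
      4 * √(fockNormSq Ω ρ (fun n ω => lowPass Λ ψ n ω - φ n ω)) := by
  have hp := hψ.lowPass Λ
  have hq := hψ.sub hp
  have hD := hp.sub hφ
  have hS := hp.add hφ
  set p := lowPass Λ ψ with hpdef
  set d := √(fockNormSq Ω ρ (fun n ω => p n ω - φ n ω)) with hd
  have hd0 : 0 ≤ d := Real.sqrt_nonneg _
  have hsplit : fockNormSq Ω ρ ψ =
      fockNormSq Ω ρ p + fockNormSq Ω ρ (fun n ω => ψ n ω - p n ω) := by
    have h := fockForm_mul_left_split (Ω := Ω) (ρ := ρ) hψ Λ 1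
    simp only [one_mul] at h
    rw [fockNormSq, h, Complex.add_re]
    rfl
  have hq0 := fockNormSq_nonneg (Ω := Ω) hρ hq
  -- Parallelogram law: `‖p + φ‖² ≤ 2‖p‖² + 2‖φ‖² ≤ 4`, where `‖p‖ ≤ 1` comes from `hsplit`.
  have hsqS : √(fockNormSq Ω ρ (fun n ω => p n ω + φ n ω)) ≤ 2 := by
    have h1 := fockNormSq_add_smul (Ω := Ω) hρ.1 hφ hp 1
    have h2 := fockNormSq_add_smul (Ω := Ω) hρ.1 hφ hp (-1)
    have h3 := fockNormSq_nonneg (Ω := Ω) hρ (hp.add (hφ.smul ((-1 : ℝ) : ℂ)))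
    rw [Complex.ofReal_one] at h1
    simp only [one_smul] at h1
    rw [Real.sqrt_le_left (by norm_num)]
    linarith
  have hA : ∀ {L : Matrix (Fin 2) (Fin 2) ℂ}, L.IsHermitian → L * L = 1 →
      |(fockForm Ω ρ p (fun n ω => L * p n ω)).re - (fockForm Ω ρ φ (fun n ω => L * φ n ω)).re| ≤
        2 * d := by
    intro L hL hL2
    rw [← re_fockForm_sub_add hρ.1 hp hφ hL]
    refine (abs_re_fockForm_le hρ (hS.mul_left L) hD).trans ?_
    rw [fockNormSq_mul_left (Ψ := fun n ω => p n ω + φ n ω) hL hL2, mul_comm]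
    exact mul_le_mul_of_nonneg_right hsqS hd0
  have h1 := hA hK hK2
  -- The choice `L = 1` controls the norm lost to unresolved bosons: `‖ψ - p‖² = 1 - ‖p‖² = ‖φ‖² -
  -- ‖p‖² ≤ 2 * d`. With `h1` for the observable itself this makes the total `4 * d`.
  have h2 := hA Matrix.isHermitian_one (one_mul 1)
  simp only [one_mul] at h2
  have h3 := abs_re_fockForm_le (Ω := Ω) hρ (hq.mul_left K) hq
  rw [fockNormSq_mul_left (Ψ := fun n ω => ψ n ω - p n ω) hK hK2, Real.mul_self_sqrt hq0] at h3
  have h4 := congrArg Complex.re (fockForm_mul_left_split (Ω := Ω) (ρ := ρ) hψ Λ K)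
  rw [Complex.add_re] at h4
  change |fockNormSq Ω ρ p - fockNormSq Ω ρ φ| ≤ 2 * d at h2
  rw [abs_le] at h1 h2 h3 ⊢
  constructor <;> linarith [h1.1, h1.2, h2.1, h2.2, h3.1, h3.2]

end Distance

/-! ### The reduced state -/

section Reduced

variable {Ω M : ℝ} {J : ℝ → ℝ} (ρ : Matrix (Fin 2) (Fin 2) ℂ)

lemma pi_bandMeasure (Ω : ℝ) (n : ℕ) : (Measure.pi fun _ : Fin n => bandMeasure Ω) =
    (volume : Measure (Fin n → ℝ)).restrict (Set.univ.pi fun _ => Set.Icc 0 Ω) := by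
  rw [volume_pi, Measure.restrict_pi_pi]
  rfl

lemma evolved_eq_zero_of_notMem_pi (hf : IsBandFamily Ω M (coupling J)) (ω₀ δ t : ℝ) {n : ℕ}
    {ω : Fin n → ℝ} (hω : ω ∉ Set.univ.pi fun _ => Set.Icc 0 Ω) : evolved ω₀ δ J t n ω = 0 := by
  simp only [Set.mem_univ_pi, not_forall] at hω
  obtain ⟨i, hi⟩ := hω
  exact evolved_eq_zero_of_notMem hf ω₀ δ t n ω i hi

lemma measurable_reducedDensity {Ψ : FockMap} (hΨ : RapidFamily fun _ => Ψ) (a b : Fin 2) :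
    Measurable fun x : BosonConfig => (Ψ x.1 x.2 * ρ * (Ψ x.1 x.2).conjTranspose) a b := by
  simp only [mul_mul_conjTranspose_apply]
  exact Finset.measurable_fun_sum _ fun c _ => Finset.measurable_fun_sum _ fun d _ =>
    (hΨ.measurable_mul_conj hΨ 0 0 a c b d).const_mul _

/-- The sector is one summand of the Fock measure, and the amplitudes vanish off the band, so
integrability extends to all frequencies. -/
lemma integrable_sector (hf : IsBandFamily Ω M (coupling J)) (ω₀ δ t : ℝ) (n : ℕ) (a b : Fin 2) :
    Integrable fun ω : Fin n → ℝ =>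
      (evolved ω₀ δ J t n ω * ρ * (evolved ω₀ δ J t n ω).conjTranspose) a b := by
  have hψ := (rapidFamily_evolved hf ω₀ δ).at_time t
  have h1 := integrable_mul_mul_conjTranspose hψ hψ Ω ρ a b
  have h2 := h1.mono_measure (Measure.le_sum _ n)
  have h3 := (integrable_map_measure (measurable_reducedDensity ρ hψ a b).aestronglyMeasurable
    (measurable_sigmaMk n).aemeasurable).1 h2
  rw [pi_bandMeasure] at h3
  refine (integrableOn_iff_integrable_of_support_subset fun ω hω => ?_).1 h3
  by_contra hn
  exact hω (by simp [evolved_eq_zero_of_notMem_pi hf ω₀ δ t hn])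

lemma sectorState_apply (hf : IsBandFamily Ω M (coupling J)) (ω₀ δ t : ℝ) (n : ℕ) (a b : Fin 2) :
    sectorState ω₀ δ J ρ t n a b = ∫ ω : Fin n → ℝ,
      (evolved ω₀ δ J t n ω * ρ * (evolved ω₀ δ J t n ω).conjTranspose) a b
        ∂(Measure.pi fun _ : Fin n => bandMeasure Ω) := by
  rw [pi_bandMeasure, setIntegral_eq_integral_of_forall_compl_eq_zero]
  · rfl
  · intro ω hω
    simp [evolved_eq_zero_of_notMem_pi hf ω₀ δ t hω]

lemma hasSum_sectorState (hf : IsBandFamily Ω M (coupling J)) (ω₀ δ t : ℝ) :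
    HasSum (fun n => sectorState ω₀ δ J ρ t n) (Matrix.of fun a b => ∫ x : BosonConfig,
      (evolved ω₀ δ J t x.1 x.2 * ρ * (evolved ω₀ δ J t x.1 x.2).conjTranspose) a b
        ∂fockMeasure Ω) := by
  have hψ := (rapidFamily_evolved hf ω₀ δ).at_time t
  refine Pi.hasSum.2 fun a => Pi.hasSum.2 fun b => ?_
  simp only [sectorState_apply ρ hf]
  exact hasSum_integral_fockMeasure (measurable_reducedDensity ρ hψ a b)
    (integrable_mul_mul_conjTranspose hψ hψ Ω ρ a b)

lemma reducedState_apply (hf : IsBandFamily Ω M (coupling J)) (ω₀ δ t : ℝ) (a b : Fin 2) :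
    reducedState ω₀ δ J ρ t a b = ∫ x : BosonConfig,
      (evolved ω₀ δ J t x.1 x.2 * ρ * (evolved ω₀ δ J t x.1 x.2).conjTranspose) a b
        ∂fockMeasure Ω := by
  rw [reducedState, (hasSum_sectorState ρ hf ω₀ δ t).tsum_eq]
  rfl

lemma expectSigmaZ_eq (hf : IsBandFamily Ω M (coupling J)) (ω₀ δ t : ℝ) :
    expectSigmaZ ω₀ δ J ρ t =
      fockForm Ω ρ (evolved ω₀ δ J t) (fun n ω => σz * evolved ω₀ δ J t n ω) := by
  have hψ := (rapidFamily_evolved hf ω₀ δ).at_time t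
  have htr : ∀ A : Matrix (Fin 2) (Fin 2) ℂ, (σz * A).trace = A 0 0 - A 1 1 := by
    intro A
    rw [Matrix.trace_fin_two, Matrix.mul_apply, Matrix.mul_apply]
    simp [σz, Fin.sum_univ_two, sub_eq_add_neg]
  simp only [expectSigmaZ, fockForm, Matrix.mul_assoc σz, htr]
  rw [integral_sub (integrable_mul_mul_conjTranspose hψ hψ Ω ρ 0 0)
    (integrable_mul_mul_conjTranspose hψ hψ Ω ρ 1 1), reducedState_apply ρ hf,
    reducedState_apply ρ hf]

variable {ρ}

lemma isDensityMatrix_reducedState (hf : IsBandFamily Ω M (coupling J)) (ω₀ δ t : ℝ)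
    (hρ : IsDensityMatrix ρ) : IsDensityMatrix (reducedState ω₀ δ J ρ t) := by
  have hψ := (rapidFamily_evolved hf ω₀ δ).at_time t
  have hi := fun a b => integrable_mul_mul_conjTranspose hψ hψ Ω ρ a b
  have hpos : ∀ x : BosonConfig,
      (evolved ω₀ δ J t x.1 x.2 * ρ * (evolved ω₀ δ J t x.1 x.2).conjTranspose).PosSemidef :=
    fun x => hρ.1.mul_mul_conjTranspose_same _
  refine ⟨Matrix.PosSemidef.of_dotProduct_mulVec_nonneg ?_ fun v => ?_, ?_⟩
  · ext a b
    rw [Matrix.conjTranspose_apply, reducedState_apply ρ hf, reducedState_apply ρ hf,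
      RCLike.star_def, ← integral_conj]
    congr 1
    funext x
    exact (hpos x).1.apply a b
  · have h1 : star v ⬝ᵥ (reducedState ω₀ δ J ρ t).mulVec v = ∫ x : BosonConfig,
        star v ⬝ᵥ (evolved ω₀ δ J t x.1 x.2 * ρ *
          (evolved ω₀ δ J t x.1 x.2).conjTranspose).mulVec v ∂fockMeasure Ω := by
      simp only [dotProduct, Matrix.mulVec, reducedState_apply ρ hf]
      rw [integral_finsetSum _ fun a _ => (integrable_finsetSum _ fun b _ =>
        (hi a b).mul_const (v b)).const_mul (star v a)]
      refine Finset.sum_congr rfl fun a _ => ?_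
      rw [integral_const_mul, integral_finsetSum _ fun b _ => (hi a b).mul_const (v b)]
      simp only [integral_mul_const]
    -- Each configuration contributes a nonnegative real number to the quadratic form, so positivity
    -- reduces to that of a real integral.
    have h2 : ∀ x : BosonConfig, star v ⬝ᵥ (evolved ω₀ δ J t x.1 x.2 * ρ *
          (evolved ω₀ δ J t x.1 x.2).conjTranspose).mulVec v =
        (((star v ⬝ᵥ (evolved ω₀ δ J t x.1 x.2 * ρ *
          (evolved ω₀ δ J t x.1 x.2).conjTranspose).mulVec v).re : ℝ) : ℂ) := fun x =>
      Complex.ext rfl (Complex.le_def.1 ((hpos x).dotProduct_mulVec_nonneg v)).2.symm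
    rw [h1, integral_congr_ae (Filter.Eventually.of_forall h2), integral_complex_ofReal]
    exact Complex.zero_le_real.2 (integral_nonneg fun x =>
      (Complex.le_def.1 ((hpos x).dotProduct_mulVec_nonneg v)).1)
  · have h1 : (reducedState ω₀ δ J ρ t).trace =
        fockForm Ω ρ (evolved ω₀ δ J t) (evolved ω₀ δ J t) := by
      simp only [fockForm, Matrix.trace, Matrix.diag_apply, reducedState_apply ρ hf]
      rw [integral_finsetSum _ fun a _ => hi a a]
    rw [h1]
    refine Complex.ext ?_ ?_
    · exact fockNormSq_evolved hf ω₀ δ hρ t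
    · exact Complex.conj_eq_iff_im.1 (fockForm_conj hρ.1.1)

lemma evolutionWellDefined (hf : IsBandFamily Ω M (coupling J)) (ω₀ δ t : ℝ)
    (hρ : IsDensityMatrix ρ) : EvolutionWellDefined ω₀ δ J ρ t :=
  ⟨summable_dysonTerm hf ω₀ δ t, integrable_sector ρ hf ω₀ δ t,
    (hasSum_sectorState ρ hf ω₀ δ t).summable, isDensityMatrix_reducedState hf ω₀ δ t hρ⟩

/-- The sampling error is bounded linearly by the error of the bath correlation function. -/
theorem samplingError_le (hJ : IsBandDensity Ω M J) (ω₀ δ : ℝ) (hρ : IsDensityMatrix ρ) {Δt : ℝ}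
    (hΔt : 0 ≤ Δt) :
    samplingError ω₀ δ J ρ Δt ≤ 4 * ∫ t' in (0 : ℝ)..Δt, ∫ t'' in (0 : ℝ)..t',
      ‖correlationError J Δt (t' - t'')‖ := by
  have hf := hJ.isBandFamily
  have hg := (hJ.sampled Δt).isBandFamily
  have him : ∀ Ψ : FockMap, (fockForm Ω ρ Ψ (fun n ω => σz * Ψ n ω)).im = 0 := fun Ψ =>
    Complex.conj_eq_iff_im.1 (by rw [fockForm_conj hρ.1.1, fockForm_mul_left isHermitian_σz])
  rw [samplingError, expectSigmaZ_eq ρ hf, expectSigmaZ_eq ρ hg]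
  have h1 : ∀ z w : ℂ, z.im = 0 → w.im = 0 → ‖z - w‖ = |z.re - w.re| := by
    intro z w hz hw
    rw [← Complex.sub_re, eq_comm, Complex.abs_re_eq_norm, Complex.sub_im, hz, hw, sub_zero]
  rw [h1 _ _ (him _) (him _)]
  refine (abs_re_fockForm_sub_le hρ.1 ((rapidFamily_evolved hf ω₀ δ).at_time Δt)
    ((rapidFamily_evolved hg ω₀ δ).at_time Δt) (fockNormSq_evolved hf ω₀ δ hρ Δt)
    (fockNormSq_evolved hg ω₀ δ hρ Δt) (Real.pi / Δt) isHermitian_σz σz_mul_σz).trans ?_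
  exact mul_le_mul_of_nonneg_left (sqrt_fockNormSq_lowPass_sub_le hJ ω₀ δ Δt hρ hΔt) (by norm_num)

end Reduced

/-! ### The sampling theorem -/

/-- **Parseval's identity** for the inner product of two functions on an interval. -/
lemma hasSum_conj_fourierCoeffOn_mul {a b : ℝ} {f g : ℝ → ℂ} (hab : a < b)
    (hf : MemLp f 2 (volume.restrict (Set.Ioc a b)))
    (hg : MemLp g 2 (volume.restrict (Set.Ioc a b))) :
    HasSum (fun i : ℤ => starRingEnd ℂ (fourierCoeffOn hab f i) * fourierCoeffOn hab g i)
      ((b - a)⁻¹ • ∫ x in a..b, starRingEnd ℂ (f x) * g x) := by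
  have := Fact.mk (by linarith : 0 < b - a)
  rw [← add_sub_cancel a b] at hf hg
  have hF := hf.memLp_liftIoc.haarAddCircle
  have hG := hg.memLp_liftIoc.haarAddCircle
  have h := fourierBasis.hasSum_inner_mul_inner hF.toLp hG.toLp
  have hcf : ∀ i : ℤ, inner ℂ (hF.toLp _) (fourierBasis i) =
      starRingEnd ℂ (fourierCoeffOn hab f i) := by
    intro i
    rw [← inner_conj_symm, ← HilbertBasis.repr_apply_apply, fourierBasis_repr,
      fourierCoeff_congr_ae hF.coeFn_toLp]
    rfl
  have hcg : ∀ i : ℤ, inner ℂ (fourierBasis i) (hG.toLp _) = fourierCoeffOn hab g i := by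
    intro i
    rw [← HilbertBasis.repr_apply_apply, fourierBasis_repr, fourierCoeff_congr_ae hG.coeFn_toLp]
    rfl
  have hin : inner ℂ (hF.toLp _) (hG.toLp _) =
      (b - a)⁻¹ • ∫ x in a..b, starRingEnd ℂ (f x) * g x := by
    have e : ∫ x in a..b, starRingEnd ℂ (f x) * g x =
        ∫ x in a..a + (b - a), starRingEnd ℂ (f x) * g x := by rw [add_sub_cancel]
    rw [e, ← AddCircle.integral_liftIoc_eq_intervalIntegral, ← AddCircle.integral_haarAddCircle,
      L2.inner_def]
    refine integral_congr_ae ?_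
    filter_upwards [hF.coeFn_toLp, hG.coeFn_toLp] with x hx hy
    rw [hx, hy, RCLike.inner_apply']
    rfl
  simpa only [hcf, hcg, hin] using h

lemma integral_exp_eq_sinc (Λ c : ℝ) :
    ∫ x in (-Λ)..Λ, Complex.exp (Complex.I * c * x) = 2 * Λ * Real.sinc (c * Λ) := by
  rcases eq_or_ne c 0 with rfl | hc
  · simp; ring
  · have h := intervalIntegral.integral_comp_mul_left (a := -Λ) (b := Λ)
      (fun t : ℝ => Complex.exp (t * Complex.I)) hc
    rw [mul_neg, integral_exp_mul_I_eq_sinc] at h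
    have e : ∀ x : ℝ, Complex.exp (Complex.I * c * x) =
        Complex.exp (((c * x : ℝ) : ℂ) * Complex.I) := fun x => by
      congr 1; push_cast; ring
    simp only [e, h, Complex.real_smul]
    have hc' : (c : ℂ) ≠ 0 := by exact_mod_cast hc
    push_cast
    field_simp

/-- **Shannon's sampling theorem** for the bath correlation function. -/
theorem hasSum_bathCorrelation_sinc {J : ℝ → ℝ} {Ω M Δt : ℝ} (hJ : IsBandDensity Ω M J)
    (hΔt : 0 < Δt) (hΩ : Ω ≤ Real.pi / Δt) (τ : ℝ) :
    HasSum (fun n : ℤ => bathCorrelation J (n * Δt) * (Real.sinc (Real.pi * (τ / Δt - n)) : ℂ))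
      (bathCorrelation J τ) := by
  set Λ := Real.pi / Δt with hΛ
  have hΛ0 : 0 < Λ := div_pos Real.pi_pos hΔt
  have hab : -Λ < Λ := by linarith
  have hT : Λ - -Λ = 2 * Λ := by ring
  -- `J` is supported in `[0, Ω]`, so integrating over one period `(-Λ, Λ]` already gives the whole
  -- correlation function.
  have hcorr : ∀ u : ℝ, ∫ x in (-Λ)..Λ, (J x : ℂ) * Complex.exp (-Complex.I * x * u) =
      bathCorrelation J u := by
    intro u
    rw [intervalIntegral.integral_of_le hab.le, bathCorrelation]
    refine setIntegral_eq_integral_of_forall_compl_eq_zero fun x hx => ?_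
    have hx' : x ∉ Set.Icc 0 Ω := fun h => hx ⟨by linarith [h.1], h.2.trans hΩ⟩
    simp [hJ.eq_zero x hx']
  have hf : MemLp (fun x : ℝ => Complex.exp (Complex.I * τ * x)) 2
      (volume.restrict (Set.Ioc (-Λ) Λ)) := by
    refine MemLp.of_bound (C := 1) (by fun_prop) (Filter.Eventually.of_forall fun x => ?_)
    have : Complex.I * τ * x = ((τ * x : ℝ) : ℂ) * Complex.I := by push_cast; ring
    rw [this, Complex.norm_exp_ofReal_mul_I]
  have hg : MemLp (fun x : ℝ => (J x : ℂ)) 2 (volume.restrict (Set.Ioc (-Λ) Λ)) := by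
    refine MemLp.of_bound (C := M ^ 2)
      (Complex.measurable_ofReal.comp hJ.measurable).aestronglyMeasurable
      (Filter.Eventually.of_forall fun x => ?_)
    rw [Complex.norm_real, Real.norm_of_nonneg (hJ.nonneg x)]
    exact (Real.sqrt_le_left ((Real.sqrt_nonneg _).trans (hJ.sqrt_le x))).1 (hJ.sqrt_le x)
  -- Parseval for `exp (i τ x)` and `J`: up to normalisation the Fourier coefficients of `J` are the
  -- samples of the correlation function, those of the exponential are the sinc weights, and the
  -- inner product is the value at `τ`.
  have h := hasSum_conj_fourierCoeffOn_mul hab hf hg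
  have hphase : ∀ (n : ℤ) (x : ℝ), fourier (-n) (x : AddCircle (Λ - -Λ)) =
      Complex.exp (-Complex.I * x * ((n * Δt : ℝ) : ℂ)) := by
    intro n x
    rw [fourier_coe_apply]
    congr 1
    have h1 : (Δt : ℂ) ≠ 0 := by exact_mod_cast hΔt.ne'
    have h2 : (Real.pi : ℂ) ≠ 0 := by exact_mod_cast Real.pi_ne_zero
    rw [hT, hΛ]
    push_cast
    field_simp
  have hcg : ∀ n : ℤ, fourierCoeffOn hab (fun x : ℝ => (J x : ℂ)) n =
      (1 / (2 * Λ) : ℝ) • bathCorrelation J (n * Δt) := by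
    intro n
    rw [fourierCoeffOn_eq_integral, ← hcorr]
    simp only [hphase, smul_eq_mul, hT]
    congr 2
    funext x
    rw [mul_comm]
  have hcf : ∀ n : ℤ, fourierCoeffOn hab (fun x : ℝ => Complex.exp (Complex.I * τ * x)) n =
      (Real.sinc (Real.pi * (τ / Δt - n)) : ℂ) := by
    intro n
    rw [fourierCoeffOn_eq_integral]
    simp only [hphase, smul_eq_mul]
    have e : ∀ x : ℝ, Complex.exp (-Complex.I * x * ((n * Δt : ℝ) : ℂ)) *
        Complex.exp (Complex.I * τ * x) =
        Complex.exp (Complex.I * ((τ - n * Δt : ℝ) : ℂ) * x) := fun x => by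
      rw [← Complex.exp_add]; congr 1; push_cast; ring
    have earg : (τ - n * Δt) * Λ = Real.pi * (τ / Δt - n) := by
      rw [hΛ]; field_simp
    simp only [e]
    rw [integral_exp_eq_sinc, earg, hT, Complex.real_smul]
    have h1 : (Λ : ℂ) ≠ 0 := by exact_mod_cast hΛ0.ne'
    push_cast
    field_simp
  have hinn : ∫ x in (-Λ)..Λ, starRingEnd ℂ (Complex.exp (Complex.I * τ * x)) * (J x : ℂ) =
      bathCorrelation J τ := by
    rw [← hcorr]
    congr 1
    funext x
    rw [← Complex.exp_conj, mul_comm]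
    congr 2
    simp
    ring
  simp only [hcg, hcf, hinn, Complex.conj_ofReal, hT] at h
  have h1 : (Λ : ℂ) ≠ 0 := by exact_mod_cast hΛ0.ne'
  have h2 := h.mul_left (2 * Λ : ℂ)
  have e1 : ∀ n : ℤ, (2 * Λ : ℂ) * ((Real.sinc (Real.pi * (τ / Δt - n)) : ℂ) *
      (1 / (2 * Λ) : ℝ) • bathCorrelation J (n * Δt)) =
      bathCorrelation J (n * Δt) * (Real.sinc (Real.pi * (τ / Δt - n)) : ℂ) := by
    intro n
    rw [Complex.real_smul]
    push_cast
    field_simp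
  have e2 : (2 * Λ : ℂ) * (2 * Λ)⁻¹ • bathCorrelation J τ = bathCorrelation J τ := by
    rw [Complex.real_smul]
    push_cast
    field_simp
  simp only [e1, e2] at h2
  exact h2

/-! ### The Ohmic bath -/

section Ohmic

variable {α ωc : ℝ}

lemma isBandDensity_ohmicSD (hα : 0 ≤ α) (hωc : 0 < ωc) :
    IsBandDensity ωc (√(2 * α * ωc)) (ohmicSD α ωc) := by
  refine ⟨Measurable.indicator (by fun_prop) measurableSet_Icc, fun x => ?_, fun x => ?_,
    fun x hx => Set.indicator_of_notMem hx _⟩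
  · refine Set.indicator_nonneg (fun x hx => ?_) x
    have := hx.1
    positivity
  · refine Real.sqrt_le_sqrt ?_
    refine Set.indicator_apply_le' (fun hx => ?_) fun _ => by positivity
    exact mul_le_mul_of_nonneg_left hx.2 (by positivity)

lemma sampledSD_ohmicSD {Δt : ℝ} (h : ωc ≤ Real.pi / Δt) :
    sampledSD (ohmicSD α ωc) Δt = ohmicSD α ωc := by
  rw [sampledSD, Set.indicator_eq_self]
  intro x hx
  exact (Set.support_indicator_subset hx).2.trans h

lemma correlationError_ohmicSD (hα : 0 ≤ α) (hωc : 0 < ωc) {Δt : ℝ} (hΔt : 0 < Δt)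
    (h : Real.pi / Δt ≤ ωc) (τ : ℝ) :
    correlationError (ohmicSD α ωc) Δt τ = ∫ ω in (Real.pi / Δt)..ωc,
      ((2 * α * ω : ℝ) : ℂ) * Complex.exp (-Complex.I * ω * τ) := by
  have hΛ : 0 < Real.pi / Δt := div_pos Real.pi_pos hΔt
  rw [(isBandDensity_ohmicSD hα hωc).correlationError_eq, bathCorrelation,
    intervalIntegral.integral_of_le h, ← integral_indicator measurableSet_Ioc]
  congr 1
  funext x
  by_cases hx : x ∈ Set.Ioc (Real.pi / Δt) ωc
  · have hx1 : x ∈ Set.Ioi (Real.pi / Δt) := hx.1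
    have hx2 : x ∈ Set.Icc 0 ωc := ⟨(hΛ.trans hx.1).le, hx.2⟩
    rw [Set.indicator_of_mem hx, unresolvedSD, Set.indicator_of_mem hx1, ohmicSD,
      Set.indicator_of_mem hx2]
  · rw [Set.indicator_of_notMem hx, unresolvedSD]
    by_cases hx1 : x ∈ Set.Ioi (Real.pi / Δt)
    · have hx2 : x ∉ Set.Icc 0 ωc := fun h2 => hx ⟨hx1, h2.2⟩
      rw [Set.indicator_of_mem hx1, ohmicSD, Set.indicator_of_notMem hx2]
      simp
    · rw [Set.indicator_of_notMem hx1]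
      simp

lemma integral_mul_exp_neg_I (α a b τ : ℝ) (hτ : τ ≠ 0) :
    ∫ ω in a..b, ((2 * α * ω : ℝ) : ℂ) * Complex.exp (-Complex.I * ω * τ) =
      2 * α / τ ^ 2 * (Complex.exp (-Complex.I * b * τ) * (1 + Complex.I * b * τ) -
        Complex.exp (-Complex.I * a * τ) * (1 + Complex.I * a * τ)) := by
  have hτ' : (τ : ℂ) ≠ 0 := by exact_mod_cast hτ
  have hd : ∀ x : ℝ, HasDerivAt (fun x : ℝ => 2 * α / τ ^ 2 *
      (Complex.exp (-Complex.I * x * τ) * (1 + Complex.I * x * τ)))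
      (((2 * α * x : ℝ) : ℂ) * Complex.exp (-Complex.I * x * τ)) x := by
    intro x
    have h0 : HasDerivAt (fun x : ℝ => (x : ℂ)) 1 x := Complex.ofRealCLM.hasDerivAt
    have h1 : HasDerivAt (fun x : ℝ => -Complex.I * x * τ) (-Complex.I * 1 * τ) x :=
      (h0.const_mul _).mul_const _
    have h2 : HasDerivAt (fun x : ℝ => 1 + Complex.I * x * τ) (Complex.I * 1 * τ) x :=
      ((h0.const_mul _).mul_const _).const_add _
    refine ((h1.cexp.mul h2).const_mul (2 * α / τ ^ 2 : ℂ)).congr_deriv ?_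
    push_cast
    field_simp
    ring_nf
    rw [Complex.I_sq]
    ring
  rw [intervalIntegral.integral_eq_sub_of_hasDerivAt (fun x _ => hd x)
    (Continuous.intervalIntegrable (by fun_prop) _ _)]
  ring

/-- The phases have modulus one, so the bound is the integral of `2 * α * ω` over the unresolved
band. -/
lemma norm_correlationError_ohmicSD_le (hα : 0 ≤ α) (hωc : 0 < ωc) {Δt : ℝ} (hΔt : 0 < Δt)
    (h : Real.pi / Δt ≤ ωc) (τ : ℝ) :
    ‖correlationError (ohmicSD α ωc) Δt τ‖ ≤ α * (ωc ^ 2 - (Real.pi / Δt) ^ 2) := by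
  have hΛ : 0 < Real.pi / Δt := div_pos Real.pi_pos hΔt
  rw [correlationError_ohmicSD hα hωc hΔt h]
  have hi : ∫ ω in (Real.pi / Δt)..ωc, 2 * α * ω = α * (ωc ^ 2 - (Real.pi / Δt) ^ 2) := by
    rw [intervalIntegral.integral_const_mul, integral_id]
    ring
  rw [← hi]
  refine intervalIntegral.norm_integral_le_of_norm_le h
    (Filter.Eventually.of_forall fun x hx => ?_)
    (Continuous.intervalIntegrable (by fun_prop) _ _)
  have hx0 : 0 ≤ x := (hΛ.trans hx.1).le
  rw [norm_mul, norm_exp_neg_I_mul, mul_one, Complex.norm_real,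
    Real.norm_of_nonneg (by positivity)]

lemma integral_integral_le_of_le {J : ℝ → ℝ} {Ω M Δt C t : ℝ} (hJ : IsBandDensity Ω M J)
    (hC : ∀ τ, ‖correlationError J Δt τ‖ ≤ C) (ht : 0 ≤ t) :
    ∫ t' in (0 : ℝ)..t, ∫ t'' in (0 : ℝ)..t', ‖correlationError J Δt (t' - t'')‖ ≤
      C * (t ^ 2 / 2) := by
  have hin : ∀ t' : ℝ, 0 ≤ t' →
      ∫ t'' in (0 : ℝ)..t', ‖correlationError J Δt (t' - t'')‖ ≤ C * t' := by
    intro t' ht'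
    refine (intervalIntegral.integral_mono_on ht' (Continuous.intervalIntegrable
      ((hJ.continuous_correlationError Δt).comp (by fun_prop)).norm _ _)
      (continuous_const.intervalIntegrable (μ := volume) 0 t') fun s _ => hC (t' - s)).trans
      (le_of_eq ?_)
    simp [mul_comm]
  refine (intervalIntegral.integral_mono_on ht
    ((hJ.continuous_integral_correlationError Δt).intervalIntegrable _ _)
    (Continuous.intervalIntegrable (by fun_prop) _ _) fun s hs => hin s hs.1).trans (le_of_eq ?_)
  rw [intervalIntegral.integral_const_mul, integral_id]
  ring

theorem samplingError_ohmicSD_le (hα : 0 ≤ α) (hωc : 0 < ωc) (ω₀ δ : ℝ)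
    {ρ : Matrix (Fin 2) (Fin 2) ℂ} (hρ : IsDensityMatrix ρ) {Δt : ℝ} (hΔt : 0 < Δt)
    (h : Real.pi / Δt ≤ ωc) :
    samplingError ω₀ δ (ohmicSD α ωc) ρ Δt ≤
      2 * Real.pi ^ 2 * α * ((ωc * Δt / Real.pi) ^ 2 - 1) := by
  have hJ := isBandDensity_ohmicSD hα hωc
  have h1 := samplingError_le hJ ω₀ δ hρ hΔt.le
  have h2 := integral_integral_le_of_le hJ
    (norm_correlationError_ohmicSD_le hα hωc hΔt h) hΔt.le
  have hπ := Real.pi_pos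
  -- The time triangle has area `Δt ^ 2 / 2`, which multiplies the uniform bound on `ΔC`.
  calc _ ≤ 4 * (α * (ωc ^ 2 - (Real.pi / Δt) ^ 2) * (Δt ^ 2 / 2)) := by linarith
    _ = _ := by field_simp; ring

end Ohmic

end SpinBoson

end

theorem mainTheorem4 (α ωc : ℝ) (hα : 0 ≤ α) (hωc : 0 < ωc) (ω₀ δ : ℝ)
    (ρ : Matrix (Fin 2) (Fin 2) ℂ) (hρ : SpinBoson.IsDensityMatrix ρ)
    (Δt : ℝ) (hΔt : 0 < Δt) :
    -- both dynamics are well defined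
    (SpinBoson.EvolutionWellDefined ω₀ δ (SpinBoson.ohmicSD α ωc) ρ Δt ∧
      SpinBoson.EvolutionWellDefined ω₀ δ
        (SpinBoson.sampledSD (SpinBoson.ohmicSD α ωc) Δt) ρ Δt) ∧
    -- the general bound of the sampling error by the error of the bath correlation function
    SpinBoson.samplingError ω₀ δ (SpinBoson.ohmicSD α ωc) ρ Δt ≤
      Real.exp (4 * ∫ t' in (0 : ℝ)..Δt, ∫ t'' in (0 : ℝ)..t',
        ‖SpinBoson.correlationError (SpinBoson.ohmicSD α ωc) Δt (t' - t'')‖) - 1 ∧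
    -- small time steps: perfect reconstruction from the samples, and no sampling error
    (Δt ≤ Real.pi / ωc →
      (∀ τ : ℝ, HasSum
        (fun n : ℤ => SpinBoson.bathCorrelation (SpinBoson.ohmicSD α ωc) (n * Δt) *
          (Real.sinc (Real.pi * (τ / Δt - n)) : ℂ))
        (SpinBoson.bathCorrelation (SpinBoson.ohmicSD α ωc) τ)) ∧
      (∀ τ : ℝ, SpinBoson.correlationError (SpinBoson.ohmicSD α ωc) Δt τ = 0) ∧
      SpinBoson.samplingError ω₀ δ (SpinBoson.ohmicSD α ωc) ρ Δt = 0) ∧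
    -- large time steps
    (Real.pi / ωc ≤ Δt →
      (∀ τ : ℝ, SpinBoson.correlationError (SpinBoson.ohmicSD α ωc) Δt τ =
        ∫ ω in (Real.pi / Δt)..ωc,
          ((2 * α * ω : ℝ) : ℂ) * Complex.exp (-Complex.I * ω * τ)) ∧
      (∀ τ : ℝ, τ ≠ 0 → SpinBoson.correlationError (SpinBoson.ohmicSD α ωc) Δt τ =
        2 * α / τ ^ 2 *
          (Complex.exp (-Complex.I * ωc * τ) * (1 + Complex.I * ωc * τ) -
            Complex.exp (-Complex.I * (Real.pi * τ / Δt)) *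
              (1 + Complex.I * (Real.pi * τ / Δt)))) ∧
      SpinBoson.samplingError ω₀ δ (SpinBoson.ohmicSD α ωc) ρ Δt ≤
        2 * Real.pi ^ 2 * α * ((ωc * Δt / Real.pi) ^ 2 - 1) ∧
      SpinBoson.samplingError ω₀ δ (SpinBoson.ohmicSD α ωc) ρ Δt ≤
        2 * α * ωc ^ 2 * Δt ^ 2) := by
  have hJ := SpinBoson.isBandDensity_ohmicSD hα hωc
  have hlin := SpinBoson.samplingError_le hJ ω₀ δ hρ hΔt.le
  refine ⟨⟨SpinBoson.evolutionWellDefined hJ.isBandFamily ω₀ δ Δt hρ,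
    SpinBoson.evolutionWellDefined (hJ.sampled Δt).isBandFamily ω₀ δ Δt hρ⟩, ?_, fun h => ?_,
    fun h => ?_⟩
  -- The linear bound implies the exponential one because `x ≤ exp x - 1`.
  · linarith [Real.add_one_le_exp (4 * ∫ t' in (0 : ℝ)..Δt, ∫ t'' in (0 : ℝ)..t',
      ‖SpinBoson.correlationError (SpinBoson.ohmicSD α ωc) Δt (t' - t'')‖)]
  · have h' : ωc ≤ Real.pi / Δt := by
      rwa [le_div_iff₀ hΔt, mul_comm, ← le_div_iff₀ hωc]
    have hs := SpinBoson.sampledSD_ohmicSD (α := α) h'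
    refine ⟨SpinBoson.hasSum_bathCorrelation_sinc hJ hΔt h', fun τ => ?_, ?_⟩
    · rw [SpinBoson.correlationError, hs, sub_self]
    · rw [SpinBoson.samplingError, hs, sub_self, norm_zero]
  · have h' : Real.pi / Δt ≤ ωc := by
      rwa [div_le_iff₀ hΔt, mul_comm, ← div_le_iff₀ hωc]
    have hb := SpinBoson.samplingError_ohmicSD_le hα hωc ω₀ δ hρ hΔt h'
    have hC := SpinBoson.correlationError_ohmicSD hα hωc hΔt h'
    refine ⟨hC, fun τ hτ => ?_, hb, hb.trans ?_⟩
    · rw [hC, SpinBoson.integral_mul_exp_neg_I α _ _ τ hτ]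
      have e : ((Real.pi / Δt : ℝ) : ℂ) * τ = Real.pi * τ / Δt := by push_cast; ring
      simp only [mul_assoc, e]
    · have hπ := Real.pi_pos
      have e : 2 * Real.pi ^ 2 * α * ((ωc * Δt / Real.pi) ^ 2 - 1) =
          2 * α * ωc ^ 2 * Δt ^ 2 - 2 * Real.pi ^ 2 * α := by field_simp
      rw [e]
      linarith [show 0 ≤ 2 * Real.pi ^ 2 * α by positivity]
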